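/- Let $D\ge 3$ and consider the $D$-dimensional static spacetime with metric $$ds^2=-f(r)\,dt^2+g(r)\,dr^2+r^2\left(d\chi^2+s(\chi)^2\,d\Omega_{D-3}^2\right),$$ where $s(\chi)=\sin\chi$ (spherical), $\chi$ (planar) or $\sinh\chi$ (hyperbolic), $d\Omega_{D-3}^2$ is the metric of the unit $(D-3)$-sphere, $r$ ranges over an open set $I\subseteq(0,\infty)$, and $f,g>0$ are $C^2$ on $I$. For $r\in I$ let $S_r$ be the timelike hypersurface of constant radius $r$. It is called a *photon surface* if for every $p\in S_r$ and every null vector $k\in T_pS_r$ some null geodesic $\gamma:(-\varepsilon,\varepsilon)\to M$ with $\dot\gamma(0)=k$ is contained in $S_r$. The radial motion of a null geodesic with energy $E$ and angular momentum $L$ obeys $\tfrac12\dot r^2+V(r)=0$, hence $\ddot r=-V'(r)$ where $\dot r\neq 0$, with $V=-\frac{1}{2fg}(E^2-fr^{-2}L^2)$. A null geodesic along $S_r$ is an orbit of constant radius; with $V$ formed from its own $E,L$, it is *stable* if every radial perturbation $\xi$ of it, in linear order $\ddot\xi=-V''(r)\,\xi$, is bounded for $\lambda\ge0$, and *unstable*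 if some such perturbation grows exponentially. The photon surface $S_r$ is stable (unstable) if every null geodesic along it is stable (unstable). Stationary radial flows of a radiation fluid on this spacetime with accretion rate $\mu\neq0$ are the level curves, in the phase space of points $(r,n)$ with $r\in I$, $n>0$, of $$F(r,n)=h(n)^2\left[f(r)+\frac{\mu^2}{r^{2(D-2)}n^2}\right],\qquad h(n)=K\,n^{\gamma-1},\quad \gamma=\frac{D}{D-1},\quad K>0.$$ A *critical point* is a point $(r,n)$ with $\partial_nF=\partial_rF=0$. It is a *saddle point* if the linearization at $(r,n)$ of the vector field $(\partial_nF,-\partial_rF)$ has two nonzero real eigenvalues of opposite signs, and an *extremum point* if that linearization has a pair of nonzero purely imaginary eigenvalues. Then for every $r\in I$: 1. there is a critical point $(r,n)$ at the radius $r$ if and only if $S_r$ is a photon surface; 2. in that case the density $n$ is unique, so that critical points and constant-$r$ photon surfaces are in one-to-one correspondence; 3. the critical point at the radius $r$ is an extremum point if and only if $S_r$ is stable, and a saddle point if and only if $S_r$ is unstable. -/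

import Mathlib

noncomputable section

namespace PhotonFluid

/-! ### Metrics, geodesics and photon surfaces in a coordinate domain -/

section Geometry

variable {ι : Type*} [Fintype ι] [DecidableEq ι]

/-- The value `g_x(v, w)` of the metric with component matrix `G x` at the point `x`. -/
def metricInner (G : (ι → ℝ) → Matrix ι ι ℝ) (x v w : ι → ℝ) : ℝ :=
  ∑ i, ∑ j, G x i j * v i * w j

/-- The partial derivative `∂_a u` at the point `x`. -/
def pderiv (a : ι) (u : (ι → ℝ) → ℝ) (x : ι → ℝ) : ℝ :=
  fderiv ℝ u x (Pi.single a 1)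

/-- The Christoffel symbols
`Γ^c_{ab} = (1/2) g^{cd} (∂_a g_{db} + ∂_b g_{da} - ∂_d g_{ab})`. -/
def christoffel (G : (ι → ℝ) → Matrix ι ι ℝ) (c a b : ι) (x : ι → ℝ) : ℝ :=
  (1 / 2) * ∑ d, (G x)⁻¹ c d *
    (pderiv a (fun y => G y d b) x + pderiv b (fun y => G y d a) x
      - pderiv d (fun y => G y a b) x)

/-- `γ` is an affinely parametrised geodesic, with parameter in the set `J`, of the metric `G`
on the coordinate domain `U`. -/
def IsGeodesicOn (G : (ι → ℝ) → Matrix ι ι ℝ) (U : Set (ι → ℝ)) (J : Set ℝ)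
    (γ : ℝ → ι → ℝ) : Prop :=
  ∀ τ ∈ J, γ τ ∈ U ∧ DifferentiableAt ℝ γ τ ∧
    HasDerivAt (deriv γ)
      (fun c => -∑ a, ∑ b, christoffel G c a b (γ τ) * deriv γ τ a * deriv γ τ b) τ

/-- A null vector is a nonzero vector of zero length. -/
def IsNull (G : (ι → ℝ) → Matrix ι ι ℝ) (x v : ι → ℝ) : Prop :=
  v ≠ 0 ∧ metricInner G x v v = 0

/-- A geodesic whose velocity is everywhere null. -/
def IsNullGeodesicOn (G : (ι → ℝ) → Matrix ι ι ℝ) (U : Set (ι → ℝ)) (J : Set ℝ)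
    (γ : ℝ → ι → ℝ) : Prop :=
  IsGeodesicOn G U J γ ∧ ∀ τ ∈ J, IsNull G (γ τ) (deriv γ τ)

/-- The level set `{φ = c}` in the coordinate domain `U`. -/
def levelSet (U : Set (ι → ℝ)) (φ : (ι → ℝ) → ℝ) (c : ℝ) : Set (ι → ℝ) :=
  {x | x ∈ U ∧ φ x = c}

/-- `v` is tangent to the level set of `φ` through `x`. -/
def IsTangent (φ : (ι → ℝ) → ℝ) (x v : ι → ℝ) : Prop :=
  fderiv ℝ φ x v = 0

/-- The level set `S = {φ = c}` is a photon surface: it is a smooth (regular) hypersurface, it is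
nowhere spacelike (each of its tangent spaces contains a nonzero causal vector), and for every
`x ∈ S` and every null `k ∈ T_x S` there is a null geodesic `γ : (-ε, ε) → M` with initial
velocity `k` at `x` that is contained in `S`. -/
def IsPhotonSurface (G : (ι → ℝ) → Matrix ι ι ℝ) (U : Set (ι → ℝ))
    (φ : (ι → ℝ) → ℝ) (c : ℝ) : Prop :=
  (∀ x ∈ levelSet U φ c, ContDiffAt ℝ ((⊤ : ℕ∞) : WithTop ℕ∞) φ x ∧ fderiv ℝ φ x ≠ 0) ∧
  (∀ x ∈ levelSet U φ c, ∃ v, v ≠ 0 ∧ IsTangent φ x v ∧ metricInner G x v v ≤ 0) ∧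
  (∀ x ∈ levelSet U φ c, ∀ k, IsTangent φ x k → IsNull G x k →
    ∃ ε > 0, ∃ γ : ℝ → ι → ℝ, IsNullGeodesicOn G U (Set.Ioo (-ε) ε) γ ∧
      γ 0 = x ∧ deriv γ 0 = k ∧ ∀ τ ∈ Set.Ioo (-ε) ε, γ τ ∈ levelSet U φ c)

end Geometry

/-! ### The static spacetimes of spherical, planar and hyperbolic symmetry -/

/-- The three kinds of spatial symmetry. -/
inductive SpatialSymmetry where
  | spherical
  | planar
  | hyperbolic

/-- `s(χ) = sin χ`, `χ`, `sinh χ`. -/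
def SpatialSymmetry.s : SpatialSymmetry → ℝ → ℝ
  | .spherical, χ => Real.sin χ
  | .planar, χ => χ
  | .hyperbolic, χ => Real.sinh χ

/-- The range of the coordinate `χ`. -/
def SpatialSymmetry.chiRange : SpatialSymmetry → Set ℝ
  | .spherical => Set.Ioo 0 Real.pi
  | .planar => Set.Ioi 0
  | .hyperbolic => Set.Ioi 0

/-- The metric
`-f(r) dt² + g(r) dr² + r² (dχ² + s(χ)² dΩ²)` in dimension `D = m + 3`, where `dΩ²` is the unit
round metric of the `m`-sphere in polar angles `θ_1, …, θ_m`. The coordinates are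
`x 0 = t`, `x 1 = r`, `x 2 = χ` and `x (j + 2) = θ_j`. -/
def staticMetric {m : ℕ} (σ : SpatialSymmetry) (f g : ℝ → ℝ) (x : Fin (m + 3) → ℝ) :
    Matrix (Fin (m + 3)) (Fin (m + 3)) ℝ :=
  Matrix.diagonal fun i =>
    if i = 0 then -f (x 1)
    else if i = 1 then g (x 1)
    else if i = 2 then x 1 ^ 2
    else x 1 ^ 2 * (σ.s (x 2) ^ 2 * ∏ j ∈ Finset.Ioo 2 i, Real.sin (x j) ^ 2)

/-- The domain of the coordinates `(t, r, χ, θ_1, …, θ_m)`, with `r` in `I`: the last angle lies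
in `(0, 2π)`, the other angles in `(0, π)`. Polar charts of this form, with varying pole, cover
the spacetime, and in each of them the metric is `staticMetric`. -/
def staticDomain {m : ℕ} (σ : SpatialSymmetry) (I : Set ℝ) : Set (Fin (m + 3) → ℝ) :=
  {x | x 1 ∈ I ∧ x 2 ∈ σ.chiRange ∧ ∀ j : Fin (m + 3), 2 < j →
    x j ∈ Set.Ioo 0 (if j = Fin.last (m + 2) then 2 * Real.pi else Real.pi)}

/-- The hypersurface `S_r` of constant radius `r` is a photon surface. -/
def IsConstRadiusPhotonSurface (m : ℕ) (σ : SpatialSymmetry) (f g : ℝ → ℝ) (I : Set ℝ)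
    (r : ℝ) : Prop :=
  IsPhotonSurface (staticMetric (m := m) σ f g) (staticDomain σ I) (fun x => x 1) r

/-! ### Stability -/

/-- The energy `E = -g(v, ∂_t)` of a geodesic with velocity `v` at `x`. -/
def energy {m : ℕ} (σ : SpatialSymmetry) (f g : ℝ → ℝ) (x v : Fin (m + 3) → ℝ) : ℝ :=
  -metricInner (staticMetric σ f g) x v (Pi.single 0 1)

/-- The square `L² = r⁴ (χ'² + s(χ)² (θ_1'² + ⋯))` of the angular momentum of a geodesic with
velocity `v` at `x`. -/
def angularMomentumSq {m : ℕ} (σ : SpatialSymmetry) (f g : ℝ → ℝ)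
    (x v : Fin (m + 3) → ℝ) : ℝ :=
  x 1 ^ 2 * ∑ i ∈ Finset.Ici 2, staticMetric σ f g x i i * v i ^ 2

/-- The effective potential `V(r) = -(E² - f r⁻² L²) / (2 f g)` of the radial motion of null
geodesics; nullness of the velocity reads `(1/2) r'² + V(r) = 0`, so that `r'' = -V'(r)`. -/
def effectivePotential (f g : ℝ → ℝ) (E Lsq : ℝ) (ρ : ℝ) : ℝ :=
  -(E ^ 2 - f ρ / ρ ^ 2 * Lsq) / (2 * f ρ * g ρ)

/-- `ξ` is a small (linearised) radial perturbation of an orbit of constant radius `r` moving in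
the potential `V`: it solves the linearisation `ξ'' = -V''(r) ξ` of `r'' = -V'(r)`. -/
def IsRadialPerturbation (V : ℝ → ℝ) (r : ℝ) (ξ : ℝ → ℝ) : Prop :=
  ∀ τ : ℝ, DifferentiableAt ℝ ξ τ ∧ HasDerivAt (deriv ξ) (-(deriv (deriv V) r * ξ τ)) τ

/-- An orbit of constant radius is stable if every small radial perturbation stays bounded. -/
def IsStableOrbit (V : ℝ → ℝ) (r : ℝ) : Prop :=
  ∀ ξ : ℝ → ℝ, IsRadialPerturbation V r ξ → ∃ C : ℝ, ∀ τ : ℝ, 0 ≤ τ → |ξ τ| ≤ C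

/-- An orbit of constant radius is unstable if some small radial perturbation grows
exponentially. -/
def IsUnstableOrbit (V : ℝ → ℝ) (r : ℝ) : Prop :=
  ∃ ξ : ℝ → ℝ, IsRadialPerturbation V r ξ ∧
    ∃ a > 0, ∃ c > 0, ∀ τ : ℝ, 0 ≤ τ → c * Real.exp (a * τ) ≤ |ξ τ|

/-- `γ` is a null geodesic, defined on `(-ε, ε)`, along the hypersurface `S_r`. -/
def IsNullGeodesicAlong {m : ℕ} (σ : SpatialSymmetry) (f g : ℝ → ℝ) (I : Set ℝ) (r ε : ℝ)
    (γ : ℝ → Fin (m + 3) → ℝ) : Prop :=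
  0 < ε ∧ IsNullGeodesicOn (staticMetric σ f g) (staticDomain σ I) (Set.Ioo (-ε) ε) γ ∧
    ∀ τ ∈ Set.Ioo (-ε) ε, γ τ 1 = r

/-- The effective potential of the geodesic `γ`, for its own energy and angular momentum. -/
def orbitPotential {m : ℕ} (σ : SpatialSymmetry) (f g : ℝ → ℝ)
    (γ : ℝ → Fin (m + 3) → ℝ) : ℝ → ℝ :=
  effectivePotential f g (energy σ f g (γ 0) (deriv γ 0))
    (angularMomentumSq σ f g (γ 0) (deriv γ 0))

/-- `S_r` is stable: every null geodesic along `S_r` is a stable orbit. -/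
def IsStableSurface (m : ℕ) (σ : SpatialSymmetry) (f g : ℝ → ℝ) (I : Set ℝ) (r : ℝ) : Prop :=
  ∀ (ε : ℝ) (γ : ℝ → Fin (m + 3) → ℝ), IsNullGeodesicAlong σ f g I r ε γ →
    IsStableOrbit (orbitPotential σ f g γ) r

/-- `S_r` is unstable: every null geodesic along `S_r` is an unstable orbit. -/
def IsUnstableSurface (m : ℕ) (σ : SpatialSymmetry) (f g : ℝ → ℝ) (I : Set ℝ) (r : ℝ) : Prop :=
  ∀ (ε : ℝ) (γ : ℝ → Fin (m + 3) → ℝ), IsNullGeodesicAlong σ f g I r ε γ →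
    IsUnstableOrbit (orbitPotential σ f g γ) r

/-! ### The accretion problem -/

/-- The function `F(r, n) = h(n)² (f(r) + μ² / (r^{2(D-2)} n²))` on the phase space `(r, n)`, whose
level curves are the stationary radial flows with accretion rate `μ` in dimension `D`
(meant for `D ≥ 2`). -/
def accretionF (D : ℕ) (f h : ℝ → ℝ) (μ : ℝ) (r n : ℝ) : ℝ :=
  h n ^ 2 * (f r + μ ^ 2 / (r ^ (2 * (D - 2)) * n ^ 2))

/-- The enthalpy per particle `h(n) = K n^{γ-1}`, `γ = (d+1)/d`, of a radiation fluid in `d = D - 1`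
spatial dimensions. -/
def radiationEnthalpy (D : ℕ) (K : ℝ) (n : ℝ) : ℝ :=
  K * n ^ ((((D : ℝ) - 1) + 1) / ((D : ℝ) - 1) - 1)

/-- The master function of radiation fluid flow. -/
def radiationF (D : ℕ) (f : ℝ → ℝ) (K μ : ℝ) : ℝ → ℝ → ℝ :=
  accretionF D f (radiationEnthalpy D K) μ

/-- `∂_r F`. -/
def partialR (F : ℝ → ℝ → ℝ) (r n : ℝ) : ℝ := deriv (fun ρ => F ρ n) r

/-- `∂_n F`. -/
def partialN (F : ℝ → ℝ → ℝ) (r n : ℝ) : ℝ := deriv (fun ν => F r ν) n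

/-- A critical point `(r, n)`, `n > 0`, of the accretion problem: a zero of the Hamiltonian vector
field `(∂_n F, -∂_r F)`. -/
def IsCriticalPoint (F : ℝ → ℝ → ℝ) (r n : ℝ) : Prop :=
  0 < n ∧ partialN F r n = 0 ∧ partialR F r n = 0

/-- The matrix of the linearisation of the vector field `(∂_n F, -∂_r F)` at `(r, n)`. -/
def linearizationMatrix (F : ℝ → ℝ → ℝ) (r n : ℝ) : Matrix (Fin 2) (Fin 2) ℝ :=
  !![partialR (partialN F) r n, partialN (partialN F) r n;
    -partialR (partialR F) r n, -partialR (partialN F) r n]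

/-- A saddle point: a critical point whose linearisation has two nonzero real eigenvalues of
opposite signs. -/
def IsSaddlePoint (F : ℝ → ℝ → ℝ) (r n : ℝ) : Prop :=
  IsCriticalPoint F r n ∧ ∃ a b : ℝ, a < 0 ∧ 0 < b ∧
    Module.End.HasEigenvalue (Matrix.toLin' (linearizationMatrix F r n)) a ∧
    Module.End.HasEigenvalue (Matrix.toLin' (linearizationMatrix F r n)) b

/-- An extremum point: a critical point whose linearisation has a pair of nonzero purely imaginary
eigenvalues. -/
def IsExtremumPoint (F : ℝ → ℝ → ℝ) (r n : ℝ) : Prop :=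
  IsCriticalPoint F r n ∧ ∃ w : ℝ, 0 < w ∧
    Module.End.HasEigenvalue
      (Matrix.toLin' ((linearizationMatrix F r n).map (fun a : ℝ => (a : ℂ)))) (w * Complex.I) ∧
    Module.End.HasEigenvalue
      (Matrix.toLin' ((linearizationMatrix F r n).map (fun a : ℝ => (a : ℂ)))) (-(w * Complex.I))

end PhotonFluid

end

noncomputable section

namespace PhotonFluid

/-! ### Geodesics of diagonal metrics and motion with one coordinate frozen. -/

section Diagonal

/-! Everything is controlled by `f(r) / r²`. Its first derivative vanishes exactly when `r f' = 2
f`, and then its second derivative has the sign of `r² f'' - 2 f`. The radial equation and the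
accretion problem both lead to these two expressions.

Geometry: the angular coefficients scale as `r²`, so for a null vector tangent to `S_r` the angular
part of the radial geodesic equation can be traded for the time part. The radial acceleration is
then a nonzero multiple of `2 f / r - f'` (`radial_acceleration`). Hence null geodesics stay on
`S_r` exactly when `r f' = 2 f` (`isConstRadiusPhotonSurface_iff`); they are constructed by solving
the geodesic equation with `r` frozen.

Stability: for such an orbit `V` is a product whose first factor has a double zero at `r`, so `V''`
is a positive multiple of `r² f'' - 2 f`, whichever null geodesic is taken. The sign of `V''`
decides the linear equation `ξ'' = -V'' ξ`.

Accretion: `∂_n F = 0` fixes the density through `f n² = (D - 2) μ² / r^{2(D-2)}`, which has one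
positive root; given this, `∂_r F = 0` becomes `r f' = 2 f`. The linearization is traceless, so its
determinant decides the type, and at a critical point this is again a positive multiple of `r² f'' -
2 f` (`linearization_det_radiationF`). -/

theorem pderiv_diagonal {ι : Type*} [DecidableEq ι] (A : (ι → ℝ) → ι → ℝ) (x : ι → ℝ) (a b c : ι) :
    pderiv a (fun y => Matrix.diagonal (A y) b c) x =
      if b = c then pderiv a (fun y => A y b) x else 0 := by
  by_cases h : b = c
  · subst h
    simp
  · simp [h, pderiv]

variable {ι : Type*} [Fintype ι] [DecidableEq ι]

theorem metricInner_diagonal (A : (ι → ℝ) → ι → ℝ) (x v w : ι → ℝ) :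
    metricInner (fun y => Matrix.diagonal (A y)) x v w = ∑ i, A x i * v i * w i := by
  simp [metricInner, Matrix.diagonal_apply, ite_mul]

theorem inv_diagonal_apply {a : ι → ℝ} (ha : ∀ i, a i ≠ 0) (c d : ι) :
    (Matrix.diagonal a)⁻¹ c d = if c = d then (a c)⁻¹ else 0 := by
  have h : (Matrix.diagonal a)⁻¹ = Matrix.diagonal fun i => (a i)⁻¹ := by
    apply Matrix.inv_eq_right_inv
    rw [Matrix.diagonal_mul_diagonal, ← Matrix.diagonal_one]
    congr 1
    funext i
    exact mul_inv_cancel₀ (ha i)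
  rw [h, Matrix.diagonal_apply]

/-- The coordinate acceleration of a geodesic of the diagonal metric with coefficients `A`. -/
def diagonalAcceleration (A : (ι → ℝ) → ι → ℝ) (x v : ι → ℝ) (c : ι) : ℝ :=
  -((A x c)⁻¹ * (∑ k, pderiv k (fun y => A y c) x * v k * v c
    - (1 / 2) * ∑ k, pderiv c (fun y => A y k) x * v k ^ 2))

/-- The inverse metric is diagonal, so only `d = c` survives, and the first two terms of the
Christoffel symbol contribute equally because `v a * v b` is symmetric. -/
theorem christoffel_diagonal_contraction (A : (ι → ℝ) → ι → ℝ) (x v : ι → ℝ)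
    (hA : ∀ i, A x i ≠ 0) (c : ι) :
    -∑ a, ∑ b, christoffel (fun y => Matrix.diagonal (A y)) c a b x * v a * v b =
      diagonalAcceleration A x v c := by
  have h : ∀ a b, christoffel (fun y => Matrix.diagonal (A y)) c a b x * v a * v b =
      (A x c)⁻¹ * ((1 / 2) * ((if c = b then pderiv a (fun y => A y c) x * v a * v b else 0)
        + (if c = a then pderiv b (fun y => A y c) x * v a * v b else 0)
        - (if a = b then pderiv c (fun y => A y a) x * v a * v b else 0))) := by
    intro a b
    simp only [christoffel, inv_diagonal_apply hA, pderiv_diagonal, ite_mul, zero_mul,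
      Finset.sum_ite_eq, Finset.mem_univ, if_true]
    split_ifs <;> ring
  simp only [h, diagonalAcceleration, ← Finset.mul_sum, Finset.sum_add_distrib,
    Finset.sum_sub_distrib, Finset.sum_ite_eq, Finset.mem_univ, if_true]
  rw [Finset.sum_comm (f := fun a b => if c = a then _ else _)]
  simp only [Finset.sum_ite_eq, Finset.mem_univ, if_true]
  have e1 : ∀ k, pderiv k (fun y => A y c) x * v c * v k
      = pderiv k (fun y => A y c) x * v k * v c := fun k => by ring
  have e2 : ∀ k, pderiv c (fun y => A y k) x * v k * v k
      = pderiv c (fun y => A y k) x * v k ^ 2 := fun k => by ring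
  simp only [e1, e2]
  ring

theorem eq_apply_zero_of_hasDerivAt_zero {u : ℝ → ℝ} {ε : ℝ}
    (h : ∀ τ ∈ Set.Ioo (-ε) ε, HasDerivAt u 0 τ) : ∀ τ ∈ Set.Ioo (-ε) ε, u τ = u 0 := by
  intro τ hτ
  have h0 : (0 : ℝ) ∈ Set.Ioo (-ε) ε := by
    have := hτ.1.trans hτ.2
    constructor <;> linarith
  exact isOpen_Ioo.is_const_of_deriv_eq_zero isPreconnected_Ioo
    (fun s hs => (h s hs).differentiableAt.differentiableWithinAt)
    (fun s hs => (h s hs).deriv) hτ h0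

theorem fderiv_eq_sum_pderiv {u : (ι → ℝ) → ℝ} (x v : ι → ℝ) :
    fderiv ℝ u x v = ∑ k, pderiv k u x * v k := by
  conv_lhs => rw [pi_eq_sum_univ' v]
  rw [map_sum]
  refine Finset.sum_congr rfl fun k _ => ?_
  rw [map_smul, smul_eq_mul, mul_comm]
  rfl

/-- The equation of motion with the coordinate `e` frozen: the geodesic equation of the
hypersurfaces of constant `e`-coordinate. -/
def frozenField (A : (ι → ℝ) → ι → ℝ) (e : ι) (p : (ι → ℝ) × (ι → ℝ)) : (ι → ℝ) × (ι → ℝ) :=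
  (p.2, fun c => if c = e then 0 else diagonalAcceleration A p.1 p.2 c)

/-- The field contains one derivative of the coefficients, so `C²` coefficients give the `C¹`
regularity that Picard–Lindelöf requires. -/
theorem contDiffAt_frozenField {A : (ι → ℝ) → ι → ℝ} {x v : ι → ℝ} (e : ι)
    (hA : ∀ i, ContDiffAt ℝ 2 (fun y => A y i) x) (hA0 : ∀ i, A x i ≠ 0) :
    ContDiffAt ℝ 1 (frozenField A e) (x, v) := by
  have hA1 : ∀ i, ContDiffAt ℝ 1 (fun p : (ι → ℝ) × (ι → ℝ) => A p.1 i) (x, v) := fun i =>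
    ContDiffAt.comp (x, v) ((hA i).of_le (by norm_num)) contDiffAt_fst
  have hp : ∀ i k, ContDiffAt ℝ 1
      (fun p : (ι → ℝ) × (ι → ℝ) => pderiv k (fun y => A y i) p.1) (x, v) := fun i k =>
    ContDiffAt.comp (x, v)
      (((hA i).fderiv_right (m := 1) (by norm_num)).clm_apply contDiffAt_const) contDiffAt_fst
  have hv : ∀ k, ContDiffAt ℝ 1 (fun p : (ι → ℝ) × (ι → ℝ) => p.2 k) (x, v) := fun k => by
    fun_prop
  refine contDiffAt_snd.prodMk (contDiffAt_pi.2 fun c => ?_)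
  by_cases h : c = e
  · simp only [h, if_true]
    exact contDiffAt_const
  · simp only [h, if_false]
    refine ContDiffAt.neg (((hA1 c).inv (hA0 c)).mul (ContDiffAt.sub ?_ ?_))
    · exact ContDiffAt.sum fun k _ => ((hp c k).mul (hv k)).mul (hv c)
    · exact contDiffAt_const.mul (ContDiffAt.sum fun k _ => (hp k c).mul ((hv k).pow 2))

/-- The squared length of the velocity is conserved by the frozen motion. -/
theorem hasDerivAt_frozen_length {A : (ι → ℝ) → ι → ℝ} {e : ι} {x v : ℝ → ι → ℝ} {τ : ℝ}
    (hA : ∀ i, DifferentiableAt ℝ (fun y => A y i) (x τ)) (hA0 : ∀ i, A (x τ) i ≠ 0)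
    (hx : HasDerivAt x (v τ) τ)
    (hv : HasDerivAt v (fun c => if c = e then 0 else diagonalAcceleration A (x τ) (v τ) c) τ)
    (he : v τ e = 0) :
    HasDerivAt (fun s => ∑ i, A (x s) i * v s i ^ 2) 0 τ := by
  have hv' := hasDerivAt_pi.1 hv
  have h1 : ∀ i, HasDerivAt (fun s => A (x s) i)
      (∑ k, pderiv k (fun y => A y i) (x τ) * v τ k) τ := fun i => by
    rw [← fderiv_eq_sum_pderiv]
    exact (hA i).hasFDerivAt.comp_hasDerivAt τ hx
  -- The equation of motion multiplied by `2 A_i v_i`; at the frozen index both sides vanish because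
  -- `v e = 0`.
  have h2 : ∀ i, 2 * A (x τ) i * v τ i *
      (if i = e then 0 else diagonalAcceleration A (x τ) (v τ) i) =
      -2 * (∑ k, pderiv k (fun y => A y i) (x τ) * v τ k) * v τ i ^ 2
        + ∑ k, pderiv i (fun y => A y k) (x τ) * v τ i * v τ k ^ 2 := fun i => by
    by_cases hi : i = e
    · subst hi
      simp [he]
    · have e1 : ∑ k, pderiv k (fun y => A y i) (x τ) * v τ k * v τ i
          = (∑ k, pderiv k (fun y => A y i) (x τ) * v τ k) * v τ i := by rw [Finset.sum_mul]
      have e2 : ∑ k, pderiv i (fun y => A y k) (x τ) * v τ i * v τ k ^ 2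
          = v τ i * ∑ k, pderiv i (fun y => A y k) (x τ) * v τ k ^ 2 := by
        rw [Finset.mul_sum]
        exact Finset.sum_congr rfl fun k _ => by ring
      rw [if_neg hi, diagonalAcceleration, e1, e2]
      have := hA0 i
      field_simp
      ring
  have h3 := HasDerivAt.fun_sum (u := Finset.univ) fun i _ => (h1 i).mul ((hv' i).pow 2)
  refine h3.congr_deriv ?_
  have h4 : ∀ i, (∑ k, pderiv k (fun y => A y i) (x τ) * v τ k) * v τ i ^ 2
        + A (x τ) i * (((2 : ℕ) : ℝ) * v τ i ^ (2 - 1) *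
          (if i = e then 0 else diagonalAcceleration A (x τ) (v τ) i))
      = -(∑ k, pderiv k (fun y => A y i) (x τ) * v τ k * v τ i ^ 2)
        + ∑ k, pderiv i (fun y => A y k) (x τ) * v τ i * v τ k ^ 2 := fun i => by
    have e3 : A (x τ) i * (((2 : ℕ) : ℝ) * v τ i ^ (2 - 1) *
          (if i = e then 0 else diagonalAcceleration A (x τ) (v τ) i))
        = 2 * A (x τ) i * v τ i *
          (if i = e then 0 else diagonalAcceleration A (x τ) (v τ) i) := by
      rw [Nat.cast_ofNat, show 2 - 1 = 1 from rfl, pow_one]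
      ring
    rw [e3, h2, ← Finset.sum_mul]
    ring
  simp only [Pi.pow_apply, h4]
  -- The two double sums differ only by exchanging `i` and `k`.
  rw [Finset.sum_add_distrib, Finset.sum_neg_distrib, Finset.sum_comm, neg_add_cancel]

/-- If the `e`-component of the acceleration of null vectors tangent to `{x e = r}` vanishes, null
geodesics with initial velocity tangent to `{x e = r}` exist inside `{x e = r}`. -/
theorem exists_nullGeodesic_frozen {A : (ι → ℝ) → ι → ℝ} {U : Set (ι → ℝ)} (hU : IsOpen U) (e : ι)
    (hA : ∀ x ∈ U, ∀ i, ContDiffAt ℝ 2 (fun y => A y i) x) (hA0 : ∀ x ∈ U, ∀ i, A x i ≠ 0)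
    {r : ℝ}
    (hacc : ∀ x ∈ U, x e = r → ∀ v : ι → ℝ, v e = 0 → ∑ i, A x i * v i ^ 2 = 0 →
      diagonalAcceleration A x v e = 0)
    {x k : ι → ℝ} (hx : x ∈ U) (hxe : x e = r) (hk : k ≠ 0) (hke : k e = 0)
    (hnull : ∑ i, A x i * k i ^ 2 = 0) :
    ∃ ε > 0, ∃ γ : ℝ → ι → ℝ,
      IsNullGeodesicOn (fun y => Matrix.diagonal (A y)) U (Set.Ioo (-ε) ε) γ ∧
      γ 0 = x ∧ deriv γ 0 = k ∧ ∀ τ ∈ Set.Ioo (-ε) ε, γ τ e = r := by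
  obtain ⟨α, hα0, ε₁, hε₁, hα⟩ :=
    (contDiffAt_frozenField (v := k) e (hA x hx) (hA0 x hx)
      ).exists_forall_mem_closedBall_exists_eq_forall_mem_Ioo_hasDerivAt₀ 0
  rw [zero_sub, zero_add] at hα
  have h0 : (0 : ℝ) ∈ Set.Ioo (-ε₁) ε₁ := ⟨by linarith, hε₁⟩
  have hc : ContinuousAt α 0 := (hα 0 h0).continuousAt
  have hev : ∀ᶠ τ in nhds (0 : ℝ), (α τ).1 ∈ U ∧ (α τ).2 ≠ 0 := by
    refine Filter.Eventually.and ?_ ?_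
    · exact (continuous_fst.continuousAt.comp hc).eventually_mem
        (hU.mem_nhds (by simpa [hα0] using hx))
    · exact (continuous_snd.continuousAt.comp hc).eventually_ne (by simpa [hα0] using hk)
  -- The interval is shrunk so that the curve stays in `U` and its velocity stays nonzero, as
  -- nullness demands.
  obtain ⟨ε₂, hε₂, h2⟩ := Metric.eventually_nhds_iff.1 hev
  refine ⟨min ε₁ ε₂, lt_min hε₁ hε₂, fun τ => (α τ).1, ?_⟩
  set ε := min ε₁ ε₂ with hε
  have hε0 : 0 < ε := lt_min hε₁ hε₂
  have hα' : ∀ τ ∈ Set.Ioo (-ε) ε, HasDerivAt α (frozenField A e (α τ)) τ := fun τ hτ =>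
    hα τ ⟨by linarith [hτ.1, min_le_left ε₁ ε₂], hτ.2.trans_le (min_le_left _ _)⟩
  have hmem : ∀ τ ∈ Set.Ioo (-ε) ε, (α τ).1 ∈ U ∧ (α τ).2 ≠ 0 := fun τ hτ => by
    refine h2 ?_
    rw [Real.dist_0_eq_abs]
    exact (abs_lt.2 hτ).trans_le (min_le_right _ _)
  have hd1 : ∀ τ ∈ Set.Ioo (-ε) ε, HasDerivAt (fun s => (α s).1) (α τ).2 τ := fun τ hτ =>
    (hasFDerivAt_fst (𝕜 := ℝ) (p := α τ)).comp_hasDerivAt τ (hα' τ hτ)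
  have hd2 : ∀ τ ∈ Set.Ioo (-ε) ε, HasDerivAt (fun s => (α s).2)
      (fun c => if c = e then 0 else diagonalAcceleration A (α τ).1 (α τ).2 c) τ := fun τ hτ =>
    (hasFDerivAt_snd (𝕜 := ℝ) (p := α τ)).comp_hasDerivAt τ (hα' τ hτ)
  have hderiv : ∀ τ ∈ Set.Ioo (-ε) ε, deriv (fun s => (α s).1) τ = (α τ).2 := fun τ hτ =>
    (hd1 τ hτ).deriv
  have hve : ∀ τ ∈ Set.Ioo (-ε) ε, (α τ).2 e = 0 := fun τ hτ => by
    have h : ∀ s ∈ Set.Ioo (-ε) ε, HasDerivAt (fun s => (α s).2 e) 0 s := fun s hs => by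
      simpa using hasDerivAt_pi.1 (hd2 s hs) e
    rw [eq_apply_zero_of_hasDerivAt_zero h τ hτ, hα0]
    exact hke
  have hxr : ∀ τ ∈ Set.Ioo (-ε) ε, (α τ).1 e = r := fun τ hτ => by
    have h : ∀ s ∈ Set.Ioo (-ε) ε, HasDerivAt (fun s => (α s).1 e) 0 s := fun s hs => by
      simpa [hve s hs] using hasDerivAt_pi.1 (hd1 s hs) e
    rw [eq_apply_zero_of_hasDerivAt_zero h τ hτ, hα0]
    exact hxe
  have hlen : ∀ τ ∈ Set.Ioo (-ε) ε, ∑ i, A (α τ).1 i * (α τ).2 i ^ 2 = 0 := fun τ hτ => by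
    have h := eq_apply_zero_of_hasDerivAt_zero (fun s hs => hasDerivAt_frozen_length
      (fun i => (hA _ (hmem s hs).1 i).differentiableAt (by norm_num)) (hA0 _ (hmem s hs).1)
      (hd1 s hs) (hd2 s hs) (hve s hs)) τ hτ
    rw [h, hα0]
    exact hnull
  have hz : (0 : ℝ) ∈ Set.Ioo (-ε) ε := ⟨by linarith, hε0⟩
  refine ⟨⟨fun τ hτ => ⟨(hmem τ hτ).1, (hd1 τ hτ).differentiableAt, ?_⟩, fun τ hτ => ?_⟩,
    by simp [hα0], by rw [hderiv 0 hz, hα0], hxr⟩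
  · have heq : deriv (fun s => (α s).1) =ᶠ[nhds τ] fun s => (α s).2 :=
      Filter.eventuallyEq_of_mem (isOpen_Ioo.mem_nhds hτ) hderiv
    refine ((hd2 τ hτ).congr_of_eventuallyEq heq).congr_deriv ?_
    funext c
    rw [hderiv τ hτ, christoffel_diagonal_contraction A _ _ (hA0 _ (hmem τ hτ).1)]
    -- Only the frozen component could violate the geodesic equation; there `hacc` applies because
    -- the velocity has remained tangent and null.
    split_ifs with hc
    · subst hc
      exact (hacc _ (hmem τ hτ).1 (hxr τ hτ) _ (hve τ hτ) (hlen τ hτ)).symm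
    · rfl
  · rw [hderiv τ hτ]
    refine ⟨(hmem τ hτ).2, ?_⟩
    rw [metricInner_diagonal]
    simpa only [mul_assoc, ← pow_two] using hlen τ hτ

end Diagonal

/-! ### Null geodesics of the static metric and the photon surface equation. -/

section Static

variable {m : ℕ} {σ : SpatialSymmetry} {f g : ℝ → ℝ} {I : Set ℝ}

/-- The diagonal entries of `staticMetric`. -/
def staticCoeff {m : ℕ} (σ : SpatialSymmetry) (f g : ℝ → ℝ) (x : Fin (m + 3) → ℝ)
    (i : Fin (m + 3)) : ℝ :=
  if i = 0 then -f (x 1)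
  else if i = 1 then g (x 1)
  else if i = 2 then x 1 ^ 2
  else x 1 ^ 2 * (σ.s (x 2) ^ 2 * ∏ j ∈ Finset.Ioo 2 i, Real.sin (x j) ^ 2)

theorem staticMetric_eq : (staticMetric (m := m) σ f g) =
    fun x => Matrix.diagonal (staticCoeff σ f g x) := rfl

theorem fin_zero_ne_one : (0 : Fin (m + 3)) ≠ 1 := by
  simp

theorem fin_two_le_iff {i : Fin (m + 3)} : 2 ≤ i ↔ i ≠ 0 ∧ i ≠ 1 := by
  simp only [Fin.le_def, Fin.ext_iff, Fin.val_two, Fin.val_zero, Fin.val_one, ne_eq]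
  omega

theorem fin_two_ne_zero : (2 : Fin (m + 3)) ≠ 0 := (fin_two_le_iff.1 le_rfl).1

theorem fin_two_ne_one : (2 : Fin (m + 3)) ≠ 1 := (fin_two_le_iff.1 le_rfl).2

@[simp] theorem staticCoeff_zero (x : Fin (m + 3) → ℝ) : staticCoeff σ f g x 0 = -f (x 1) := by
  simp [staticCoeff]

@[simp] theorem staticCoeff_one (x : Fin (m + 3) → ℝ) : staticCoeff σ f g x 1 = g (x 1) := by
  simp [staticCoeff]

/-- The metric coefficient of an angular coordinate on the unit space form. -/
def angularCoeff {m : ℕ} (σ : SpatialSymmetry) (x : Fin (m + 3) → ℝ) (i : Fin (m + 3)) : ℝ :=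
  if i = 2 then 1 else σ.s (x 2) ^ 2 * ∏ j ∈ Finset.Ioo 2 i, Real.sin (x j) ^ 2

theorem staticCoeff_angular {i : Fin (m + 3)} (h0 : i ≠ 0) (h1 : i ≠ 1) :
    (fun x => staticCoeff σ f g x i) = fun x => x 1 ^ 2 * angularCoeff σ x i := by
  funext x
  simp only [staticCoeff, angularCoeff, h0, h1, if_false]
  split_ifs <;> simp

theorem SpatialSymmetry.s_contDiff (σ : SpatialSymmetry) {k : WithTop ℕ∞} :
    ContDiff ℝ k σ.s := by
  cases σ
  · exact Real.contDiff_sin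
  · exact contDiff_id
  · exact Real.contDiff_sinh

theorem SpatialSymmetry.s_pos (σ : SpatialSymmetry) {χ : ℝ} (h : χ ∈ σ.chiRange) :
    0 < σ.s χ := by
  cases σ
  · exact Real.sin_pos_of_mem_Ioo h
  · exact h
  · exact Real.sinh_pos_iff.2 h

theorem contDiff_angularCoeff (i : Fin (m + 3)) {k : WithTop ℕ∞} :
    ContDiff ℝ k fun x => angularCoeff (m := m) σ x i := by
  unfold angularCoeff
  split_ifs
  · exact contDiff_const
  · refine ContDiff.mul ((σ.s_contDiff.comp (contDiff_apply ℝ ℝ _)).pow 2) ?_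
    exact contDiff_prod fun j _ => (Real.contDiff_sin.comp (contDiff_apply ℝ ℝ _)).pow 2

theorem angularCoeff_pos {x : Fin (m + 3) → ℝ} (hx : x ∈ staticDomain σ I) (i : Fin (m + 3)) :
    0 < angularCoeff σ x i := by
  unfold angularCoeff
  split_ifs
  · exact one_pos
  · refine mul_pos (pow_pos (σ.s_pos hx.2.1) 2) (Finset.prod_pos fun j hj => ?_)
    rw [Finset.mem_Ioo] at hj
    have h := hx.2.2 j hj.1
    -- An index strictly below `i` is never the last angle, so its range is `(0, π)`, where the sine
    -- is positive.
    rw [if_neg (hj.2.trans_le (Fin.le_last i)).ne] at h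
    exact pow_pos (Real.sin_pos_of_mem_Ioo h) 2

theorem staticCoeff_pos (hIpos : ∀ r ∈ I, 0 < r) (hgpos : ∀ r ∈ I, 0 < g r)
    {x : Fin (m + 3) → ℝ} (hx : x ∈ staticDomain σ I) {i : Fin (m + 3)} (hi : i ≠ 0) :
    0 < staticCoeff σ f g x i := by
  by_cases h1 : i = 1
  · subst h1
    simpa using hgpos _ hx.1
  · rw [congrFun (staticCoeff_angular hi h1) x]
    exact mul_pos (pow_pos (hIpos _ hx.1) 2) (angularCoeff_pos hx i)

theorem staticCoeff_ne_zero (hIpos : ∀ r ∈ I, 0 < r) (hfpos : ∀ r ∈ I, 0 < f r)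
    (hgpos : ∀ r ∈ I, 0 < g r) {x : Fin (m + 3) → ℝ} (hx : x ∈ staticDomain σ I)
    (i : Fin (m + 3)) : staticCoeff σ f g x i ≠ 0 := by
  by_cases h0 : i = 0
  · subst h0
    simpa using (hfpos _ hx.1).ne'
  · exact (staticCoeff_pos hIpos hgpos hx h0).ne'

theorem contDiffAt_staticCoeff (hI : IsOpen I) (hf : ContDiffOn ℝ 2 f I)
    (hg : ContDiffOn ℝ 2 g I) {x : Fin (m + 3) → ℝ} (hx : x 1 ∈ I) (i : Fin (m + 3)) :
    ContDiffAt ℝ 2 (fun y => staticCoeff σ f g y i) x := by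
  have hx1 : ContDiffAt ℝ 2 (fun y : Fin (m + 3) → ℝ => y 1) x := by fun_prop
  by_cases h0 : i = 0
  · subst h0
    simp only [staticCoeff_zero]
    exact (ContDiffAt.comp x (hf.contDiffAt (hI.mem_nhds hx)) hx1).neg
  by_cases h1 : i = 1
  · subst h1
    simp only [staticCoeff_one]
    exact ContDiffAt.comp x (hg.contDiffAt (hI.mem_nhds hx)) hx1
  · rw [staticCoeff_angular h0 h1]
    exact (hx1.pow 2).mul (contDiff_angularCoeff i).contDiffAt

theorem isOpen_staticDomain (hI : IsOpen I) : IsOpen (staticDomain (m := m) σ I) := by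
  have hχ : IsOpen σ.chiRange := by
    cases σ
    · exact isOpen_Ioo
    · exact isOpen_Ioi
    · exact isOpen_Ioi
  have h3 : {x : Fin (m + 3) → ℝ | ∀ j : Fin (m + 3), 2 < j →
      x j ∈ Set.Ioo 0 (if j = Fin.last (m + 2) then 2 * Real.pi else Real.pi)} =
      ⋂ j : Fin (m + 3), ⋂ _ : 2 < j, (fun x => x j) ⁻¹'
        Set.Ioo 0 (if j = Fin.last (m + 2) then 2 * Real.pi else Real.pi) := by
    ext x
    simp
  refine (hI.preimage (continuous_apply 1)).inter ((hχ.preimage (continuous_apply 2)).inter ?_)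
  change IsOpen {x : Fin (m + 3) → ℝ | ∀ j : Fin (m + 3), 2 < j →
      x j ∈ Set.Ioo 0 (if j = Fin.last (m + 2) then 2 * Real.pi else Real.pi)}
  rw [h3]
  exact isOpen_iInter_of_finite fun j => isOpen_iInter_of_finite fun _ =>
    isOpen_Ioo.preimage (continuous_apply j)

theorem exists_mem_staticDomain {r : ℝ} (hr : r ∈ I) :
    ∃ x : Fin (m + 3) → ℝ, x ∈ staticDomain σ I ∧ x 1 = r := by
  have hpi := Real.pi_gt_three
  -- The value `1` lies in every admissible coordinate range.
  refine ⟨fun i => if i = 1 then r else 1, ⟨by simpa using hr, ?_, fun j hj => ?_⟩, by simp⟩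
  · simp only [fin_two_ne_one, if_false]
    cases σ
    · exact ⟨one_pos, by linarith⟩
    · exact Set.mem_Ioi.2 one_pos
    · exact Set.mem_Ioi.2 one_pos
  · have h1 : j ≠ 1 := (fin_two_le_iff.1 hj.le).2
    simp only [h1, if_false]
    split_ifs
    · exact ⟨one_pos, by linarith⟩
    · exact ⟨one_pos, by linarith⟩

theorem pderiv_eq_deriv {ι : Type*} [DecidableEq ι] [Fintype ι] {u : (ι → ℝ) → ℝ} {x : ι → ℝ}
    (hu : DifferentiableAt ℝ u x) (a : ι) :
    pderiv a u x = deriv (fun t => u (Function.update x a t)) (x a) := by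
  have h := hu.hasFDerivAt
  rw [← Function.update_eq_self a x] at h
  have h' := h.comp_hasDerivAt (x a) (hasDerivAt_update x a (x a))
  rw [Function.update_eq_self] at h'
  exact h'.deriv.symm

theorem pderiv_radial_staticCoeff_zero (hI : IsOpen I) (hf : ContDiffOn ℝ 2 f I)
    (hg : ContDiffOn ℝ 2 g I) {x : Fin (m + 3) → ℝ} (hx : x 1 ∈ I) :
    pderiv 1 (fun y => staticCoeff σ f g y 0) x = -deriv f (x 1) := by
  rw [pderiv_eq_deriv ((contDiffAt_staticCoeff hI hf hg hx 0).differentiableAt (by norm_num))]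
  simp

theorem angularCoeff_update (x : Fin (m + 3) → ℝ) (i : Fin (m + 3)) (t : ℝ) :
    angularCoeff σ (Function.update x 1 t) i = angularCoeff σ x i := by
  unfold angularCoeff
  rw [Function.update_of_ne fin_two_ne_one]
  congr 2
  refine Finset.prod_congr rfl fun j hj => ?_
  rw [Function.update_of_ne (fin_two_le_iff.1 (Finset.mem_Ioo.1 hj).1.le).2]

/-- The angular coefficients are homogeneous of degree two in `r`. A factor `2 / r` common to all of
them is what lets the null condition eliminate their sum. -/
theorem pderiv_radial_staticCoeff (hI : IsOpen I) (hIpos : ∀ r ∈ I, 0 < r)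
    (hf : ContDiffOn ℝ 2 f I) (hg : ContDiffOn ℝ 2 g I) {x : Fin (m + 3) → ℝ} (hx : x 1 ∈ I)
    {i : Fin (m + 3)} (h0 : i ≠ 0) (h1 : i ≠ 1) :
    pderiv 1 (fun y => staticCoeff σ f g y i) x = 2 / x 1 * staticCoeff σ f g x i := by
  rw [pderiv_eq_deriv ((contDiffAt_staticCoeff hI hf hg hx i).differentiableAt (by norm_num)),
    congrFun (staticCoeff_angular h0 h1) x]
  have h : (fun t => staticCoeff σ f g (Function.update x 1 t) i) =
      fun t => t ^ 2 * angularCoeff σ x i := by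
    funext t
    rw [congrFun (staticCoeff_angular h0 h1) (Function.update x 1 t), angularCoeff_update]
    simp
  have hr := (hIpos _ hx).ne'
  rw [h, ((hasDerivAt_pow 2 (x 1)).mul_const _).deriv]
  field_simp
  norm_num
  ring

/-- The radial acceleration of a null geodesic whose velocity is tangent to `S_r`. -/
theorem radial_acceleration (hI : IsOpen I) (hIpos : ∀ r ∈ I, 0 < r)
    (hf : ContDiffOn ℝ 2 f I) (hg : ContDiffOn ℝ 2 g I) {x v : Fin (m + 3) → ℝ} (hx : x 1 ∈ I)
    (hv : v 1 = 0) (hnull : ∑ i, staticCoeff σ f g x i * v i ^ 2 = 0) :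
    diagonalAcceleration (staticCoeff σ f g) x v 1 =
      (g (x 1))⁻¹ * (1 / 2) * ((2 * f (x 1) / x 1 - deriv f (x 1)) * v 0 ^ 2) := by
  -- Each term is `2 / r` times a term of the null condition, with a correction at `k = 0` only; the
  -- sum therefore reduces to that correction.
  have h : ∀ k, pderiv 1 (fun y => staticCoeff σ f g y k) x * v k ^ 2 =
      2 / x 1 * (staticCoeff σ f g x k * v k ^ 2) +
        if k = 0 then (2 * f (x 1) / x 1 - deriv f (x 1)) * v 0 ^ 2 else 0 := fun k => by
    by_cases h0 : k = 0
    · subst h0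
      rw [pderiv_radial_staticCoeff_zero hI hf hg hx, if_pos rfl, staticCoeff_zero]
      ring
    by_cases h1 : k = 1
    · subst h1
      simp [hv]
    · rw [pderiv_radial_staticCoeff hI hIpos hf hg hx h0 h1, if_neg h0]
      ring
  simp only [diagonalAcceleration, h, hv, mul_zero, Finset.sum_const_zero, staticCoeff_one,
    Finset.sum_add_distrib, ← Finset.mul_sum, hnull, Finset.sum_ite_eq', Finset.mem_univ, if_true]
  ring

/-- Time is the only negative direction, so a null vector without time component would vanish. -/
theorem time_component_ne_zero (hIpos : ∀ r ∈ I, 0 < r) (hgpos : ∀ r ∈ I, 0 < g r)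
    {x v : Fin (m + 3) → ℝ} (hx : x ∈ staticDomain σ I) (hv : v ≠ 0)
    (hnull : ∑ i, staticCoeff σ f g x i * v i ^ 2 = 0) : v 0 ≠ 0 := by
  intro h0
  apply hv
  have hnn : ∀ i ∈ Finset.univ, 0 ≤ staticCoeff σ f g x i * v i ^ 2 := fun i _ => by
    by_cases hi : i = 0
    · subst hi
      simp [h0]
    · exact mul_nonneg (staticCoeff_pos hIpos hgpos hx hi).le (sq_nonneg _)
  funext i
  by_cases hi : i = 0
  · subst hi
    exact h0
  · have := (Finset.sum_eq_zero_iff_of_nonneg hnn).1 hnull i (Finset.mem_univ i)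
    simpa [(staticCoeff_pos (f := f) hIpos hgpos hx hi).ne'] using this

theorem isNull_static_iff {x v : Fin (m + 3) → ℝ} :
    IsNull (staticMetric σ f g) x v ↔ v ≠ 0 ∧ ∑ i, staticCoeff σ f g x i * v i ^ 2 = 0 := by
  rw [IsNull, staticMetric_eq, metricInner_diagonal]
  simp only [mul_assoc, ← pow_two]

theorem fderiv_coordinate {ι : Type*} [Fintype ι] (e : ι) (x v : ι → ℝ) :
    fderiv ℝ (fun y : ι → ℝ => y e) x v = v e := by
  have h : HasFDerivAt (fun y : ι → ℝ => y e) (ContinuousLinearMap.proj (R := ℝ) e) x :=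
    (ContinuousLinearMap.proj (R := ℝ) (φ := fun _ : ι => ℝ) e).hasFDerivAt
  rw [h.fderiv]
  rfl

/-- A null vector tangent to `S_r` exists at each point. -/
theorem exists_tangent_null {x : Fin (m + 3) → ℝ} (hr : 0 < x 1) (hfr : 0 < f (x 1)) :
    ∃ k : Fin (m + 3) → ℝ, k ≠ 0 ∧ k 1 = 0 ∧ ∑ i, staticCoeff σ f g x i * k i ^ 2 = 0 := by
  -- The vector `r ∂_t + √f ∂_χ`, of squared length `-f r² + r² f = 0`.
  refine ⟨fun i => if i = 0 then x 1 else if i = 2 then √(f (x 1)) else 0, fun h => ?_, ?_, ?_⟩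
  · have := congrFun h 0
    simp [hr.ne'] at this
  · simp [fin_two_ne_one.symm]
  · rw [Finset.sum_eq_add 0 2 fin_two_ne_zero.symm]
    · simp [staticCoeff, fin_two_ne_zero, fin_two_ne_one, Real.sq_sqrt hfr.le]
      ring
    · intro i _ hi
      simp [hi.1, hi.2]
    · simp
    · simp

theorem exists_nullGeodesicAlong (hI : IsOpen I) (hIpos : ∀ r ∈ I, 0 < r)
    (hf : ContDiffOn ℝ 2 f I) (hg : ContDiffOn ℝ 2 g I) (hfpos : ∀ r ∈ I, 0 < f r)
    (hgpos : ∀ r ∈ I, 0 < g r) {r : ℝ} (hr : r ∈ I) (hcrit : r * deriv f r = 2 * f r)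
    {x k : Fin (m + 3) → ℝ} (hx : x ∈ staticDomain σ I) (hxr : x 1 = r) (hk : k ≠ 0)
    (hk1 : k 1 = 0) (hnull : ∑ i, staticCoeff σ f g x i * k i ^ 2 = 0) :
    ∃ ε γ, IsNullGeodesicAlong σ f g I r ε γ ∧ γ 0 = x ∧ deriv γ 0 = k := by
  obtain ⟨ε, hε, γ, hγ, h0, h1, h2⟩ := exists_nullGeodesic_frozen (A := staticCoeff σ f g)
    (isOpen_staticDomain hI) 1 (fun y hy => contDiffAt_staticCoeff hI hf hg hy.1)
    (fun y hy => staticCoeff_ne_zero hIpos hfpos hgpos hy) (r := r)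
    (fun y hy hyr v hv hvn => by
      have hr0 := (hIpos r hr).ne'
      have : 2 * f r / r - deriv f r = 0 := by
        rw [← hcrit]
        field_simp
        ring
      rw [radial_acceleration hI hIpos hf hg hy.1 hv hvn, hyr, this, zero_mul, mul_zero])
    hx hxr hk hk1 hnull
  exact ⟨ε, γ, ⟨hε, hγ, h2⟩, h0, h1⟩

/-- The velocity of a null geodesic along `S_r` has no radial component, is null, and the radial
geodesic equation holds. -/
theorem IsNullGeodesicAlong.crit (hI : IsOpen I) (hIpos : ∀ r ∈ I, 0 < r)
    (hf : ContDiffOn ℝ 2 f I) (hg : ContDiffOn ℝ 2 g I) (hfpos : ∀ r ∈ I, 0 < f r)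
    (hgpos : ∀ r ∈ I, 0 < g r) {r ε : ℝ} (hr : r ∈ I) {γ : ℝ → Fin (m + 3) → ℝ}
    (hγ : IsNullGeodesicAlong σ f g I r ε γ) :
    γ 0 ∈ staticDomain σ I ∧ γ 0 1 = r ∧ deriv γ 0 0 ≠ 0 ∧ deriv γ 0 1 = 0 ∧
      ∑ i, staticCoeff σ f g (γ 0) i * deriv γ 0 i ^ 2 = 0 ∧ r * deriv f r = 2 * f r := by
  obtain ⟨hε, ⟨hgeo, hnull⟩, hrad⟩ := hγ
  have hz : (0 : ℝ) ∈ Set.Ioo (-ε) ε := ⟨by linarith, hε⟩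
  obtain ⟨hU, hd, hdd⟩ := hgeo 0 hz
  obtain ⟨hv, hn⟩ := isNull_static_iff.1 (hnull 0 hz)
  have hv0 := time_component_ne_zero hIpos hgpos hU hv hn
  have hv1 : ∀ τ ∈ Set.Ioo (-ε) ε, deriv γ τ 1 = 0 := fun τ hτ => by
    have h1 := hasDerivAt_pi.1 (hgeo τ hτ).2.1.hasDerivAt 1
    have h2 : (fun s => γ s 1) =ᶠ[nhds τ] fun _ => r :=
      Filter.eventuallyEq_of_mem (isOpen_Ioo.mem_nhds hτ) hrad
    exact h1.unique ((hasDerivAt_const τ r).congr_of_eventuallyEq h2)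
  -- The radial velocity vanishes on the whole interval, so its derivative, the radial acceleration,
  -- vanishes as well.
  have hacc : diagonalAcceleration (staticCoeff σ f g) (γ 0) (deriv γ 0) 1 = 0 := by
    have h1 := hasDerivAt_pi.1 hdd 1
    have h2 : (fun s => deriv γ s 1) =ᶠ[nhds 0] fun _ => (0 : ℝ) :=
      Filter.eventuallyEq_of_mem (isOpen_Ioo.mem_nhds hz) hv1
    have h3 := h1.unique ((hasDerivAt_const (0 : ℝ) (0 : ℝ)).congr_of_eventuallyEq h2)
    rwa [staticMetric_eq, christoffel_diagonal_contraction _ _ _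
      (staticCoeff_ne_zero hIpos hfpos hgpos hU)] at h3
  refine ⟨hU, hrad 0 hz, hv0, hv1 0 hz, hn, ?_⟩
  rw [radial_acceleration hI hIpos hf hg hU.1 (hv1 0 hz) hn, hrad 0 hz] at hacc
  have hr0 := (hIpos r hr).ne'
  have hg0 := (hgpos r hr).ne'
  have : 2 * f r / r - deriv f r = 0 := by
    simpa [hg0, hv0] using hacc
  field_simp at this
  linarith

/-- One null geodesic along `S_r` already forces the equation, so a single point and a single null
vector suffice in one direction. In the other, `∂_t` is the required causal tangent vector. -/
theorem isConstRadiusPhotonSurface_iff (hI : IsOpen I) (hIpos : ∀ r ∈ I, 0 < r)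
    (hf : ContDiffOn ℝ 2 f I) (hg : ContDiffOn ℝ 2 g I) (hfpos : ∀ r ∈ I, 0 < f r)
    (hgpos : ∀ r ∈ I, 0 < g r) {r : ℝ} (hr : r ∈ I) :
    IsConstRadiusPhotonSurface m σ f g I r ↔ r * deriv f r = 2 * f r := by
  constructor
  · rintro ⟨-, -, h⟩
    obtain ⟨x, hx, hxr⟩ := exists_mem_staticDomain (m := m) (σ := σ) hr
    obtain ⟨k, hk, hk1, hn⟩ := exists_tangent_null (σ := σ) (f := f) (g := g) (x := x)
      (hIpos _ hx.1) (hfpos _ hx.1)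
    obtain ⟨ε, hε, γ, hγ, -, -, hγr⟩ := h x ⟨hx, hxr⟩ k
      (by rw [IsTangent, fderiv_coordinate]; exact hk1) (isNull_static_iff.2 ⟨hk, hn⟩)
    exact (IsNullGeodesicAlong.crit hI hIpos hf hg hfpos hgpos hr
      ⟨hε, hγ, fun τ hτ => (hγr τ hτ).2⟩).2.2.2.2.2
  · intro hcrit
    refine ⟨fun x _ => ⟨by fun_prop, fun h => ?_⟩, fun x hx => ⟨Pi.single 0 1, ?_, ?_, ?_⟩, ?_⟩
    · have := DFunLike.congr_fun h (Pi.single 1 1)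
      rw [fderiv_coordinate] at this
      simp at this
    · simp
    · rw [IsTangent, fderiv_coordinate]
      simp [fin_zero_ne_one.symm]
    · rw [staticMetric_eq, metricInner_diagonal]
      simpa [Pi.single_apply] using (hfpos _ hx.1.1).le
    · rintro x ⟨hx, hxr⟩ k hk hkn
      rw [IsTangent, fderiv_coordinate] at hk
      obtain ⟨hk0, hn⟩ := isNull_static_iff.1 hkn
      obtain ⟨ε, γ, ⟨hε, hγ, hγr⟩, h0, h1⟩ :=
        exists_nullGeodesicAlong hI hIpos hf hg hfpos hgpos hr hcrit hx hxr hk0 hk hn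
      exact ⟨ε, hε, γ, hγ, h0, h1, fun τ hτ => ⟨(hγ.1 τ hτ).1, hγr τ hτ⟩⟩

end Static

/-! ### Linear radial perturbations and the second derivative of the potential. -/

section Stability

/-- The first integral of the oscillator equation; for `V'' > 0` it is positive definite and bounds
`ξ`. -/
theorem IsRadialPerturbation.energy_const {V : ℝ → ℝ} {r : ℝ} {ξ : ℝ → ℝ}
    (h : IsRadialPerturbation V r ξ) (τ : ℝ) :
    deriv ξ τ ^ 2 + deriv (deriv V) r * ξ τ ^ 2 =
      deriv ξ 0 ^ 2 + deriv (deriv V) r * ξ 0 ^ 2 := by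
  have hd : ∀ s, HasDerivAt (fun s => deriv ξ s ^ 2 + deriv (deriv V) r * ξ s ^ 2) 0 s :=
    fun s => by
      refine (((h s).2.pow 2).add (((h s).1.hasDerivAt.pow 2).const_mul _)).congr_deriv ?_
      push_cast
      ring
  exact is_const_of_deriv_eq_zero (fun s => (hd s).differentiableAt) (fun s => (hd s).deriv) τ 0

theorem IsRadialPerturbation.bounded {V : ℝ → ℝ} {r : ℝ} {ξ : ℝ → ℝ}
    (h : IsRadialPerturbation V r ξ) (hV : 0 < deriv (deriv V) r) :
    ∃ C : ℝ, ∀ τ, |ξ τ| ≤ C := by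
  set w := deriv (deriv V) r with hw
  refine ⟨(deriv ξ 0 ^ 2 + w * ξ 0 ^ 2) / w + 1, fun τ => ?_⟩
  have h1 := h.energy_const τ
  rw [← hw] at h1
  have h2 : ξ τ ^ 2 ≤ (deriv ξ 0 ^ 2 + w * ξ 0 ^ 2) / w := by
    rw [le_div_iff₀ hV]
    nlinarith [sq_nonneg (deriv ξ τ)]
  have h3 : |ξ τ| ≤ ξ τ ^ 2 + 1 := by
    rw [← sq_abs]
    nlinarith [sq_nonneg (|ξ τ| - 1 / 2)]
  linarith

theorem IsRadialPerturbation.affine {V : ℝ → ℝ} {r : ℝ} {ξ : ℝ → ℝ}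
    (h : IsRadialPerturbation V r ξ) (hV : deriv (deriv V) r = 0) (τ : ℝ) :
    ξ τ = ξ 0 + deriv ξ 0 * τ := by
  have h1 : ∀ s, deriv ξ s = deriv ξ 0 := fun s =>
    is_const_of_deriv_eq_zero (fun s => (h s).2.differentiableAt)
      (fun s => by rw [(h s).2.deriv, hV]; ring) s 0
  have hd : ∀ s, HasDerivAt (fun s => ξ s - deriv ξ 0 * s) 0 s := fun s => by
    refine ((h s).1.hasDerivAt.sub ((hasDerivAt_id s).const_mul (deriv ξ 0))).congr_deriv ?_
    rw [h1 s]
    ring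
  have h2 := is_const_of_deriv_eq_zero (fun s => (hd s).differentiableAt)
    (fun s => (hd s).deriv) τ 0
  simp only [mul_zero, sub_zero] at h2
  linarith

/-- Excludes exponential growth for bounded perturbations (`β = 0`) and for the affine ones of the
marginal case `V'' = 0`. -/
theorem not_exp_le_affine {a c α β : ℝ} (ha : 0 < a) (hc : 0 < c) (hα : 0 ≤ α) (hβ : 0 ≤ β) :
    ¬ ∀ τ : ℝ, 0 ≤ τ → c * Real.exp (a * τ) ≤ α + β * τ := by
  intro h
  have hk : 0 < c * a ^ 2 / 2 := by positivity
  -- Chosen so that the quadratic lower bound for the exponential at `T` equals `(c a² / 2 + α + β)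
  -- T`, which exceeds `α + β T` since `T ≥ 1`.
  set T := 1 + (α + β) / (c * a ^ 2 / 2) with hT
  have hT1 : 1 ≤ T := by
    rw [hT]
    have : 0 ≤ (α + β) / (c * a ^ 2 / 2) := by positivity
    linarith
  have h1 := h T (by linarith)
  have h2 := Real.quadratic_le_exp_of_nonneg (x := a * T) (by positivity)
  have h3 : c * a ^ 2 / 2 * T = c * a ^ 2 / 2 + (α + β) := by
    rw [hT]
    field_simp
  have h4 : c * (a * T) ^ 2 / 2 ≤ c * Real.exp (a * T) := by
    have : (a * T) ^ 2 / 2 ≤ Real.exp (a * T) := by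
      have : 0 ≤ a * T := by positivity
      linarith
    calc c * (a * T) ^ 2 / 2 = c * ((a * T) ^ 2 / 2) := by ring
      _ ≤ _ := mul_le_mul_of_nonneg_left this hc.le
  have h5 : c * (a * T) ^ 2 / 2 = (c * a ^ 2 / 2 * T) * T := by ring
  rw [h5, h3] at h4
  nlinarith

theorem isRadialPerturbation_exp {V : ℝ → ℝ} {r : ℝ} (hV : deriv (deriv V) r ≤ 0) :
    IsRadialPerturbation V r fun τ => Real.exp (√(-deriv (deriv V) r) * τ) := by
  set a := √(-deriv (deriv V) r) with ha
  have haa : a * a = -deriv (deriv V) r := Real.mul_self_sqrt (by linarith)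
  have hd : ∀ τ, HasDerivAt (fun s => Real.exp (a * s)) (a * Real.exp (a * τ)) τ := fun τ => by
    refine ((hasDerivAt_id τ).const_mul a).exp.congr_deriv ?_
    simp only [id]
    ring
  intro τ
  refine ⟨(hd τ).differentiableAt, ?_⟩
  rw [show deriv (fun s => Real.exp (a * s)) = fun s => a * Real.exp (a * s) from
    funext fun s => (hd s).deriv]
  refine ((hd τ).const_mul a).congr_deriv ?_
  rw [← mul_assoc, haa]
  ring

theorem isUnstableOrbit_iff {V : ℝ → ℝ} {r : ℝ} :
    IsUnstableOrbit V r ↔ deriv (deriv V) r < 0 := by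
  constructor
  · rintro ⟨ξ, hξ, a, ha, c, hc, h⟩
    by_contra! hV
    rcases hV.eq_or_lt with h0 | h0
    · refine not_exp_le_affine ha hc (abs_nonneg (ξ 0)) (abs_nonneg (deriv ξ 0)) fun τ hτ =>
        (h τ hτ).trans ?_
      rw [hξ.affine h0.symm τ]
      refine (abs_add_le _ _).trans_eq ?_
      rw [abs_mul, abs_of_nonneg hτ]
    · obtain ⟨C, hC⟩ := hξ.bounded h0
      refine not_exp_le_affine ha hc ((abs_nonneg _).trans (hC 0)) le_rfl fun τ hτ =>
        (h τ hτ).trans ?_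
      simpa using hC τ
  · intro hV
    exact ⟨_, isRadialPerturbation_exp hV.le, _, Real.sqrt_pos.2 (neg_pos.2 hV), 1, one_pos,
      fun τ _ => by rw [one_mul, abs_of_pos (Real.exp_pos _)]⟩

theorem isStableOrbit_iff {V : ℝ → ℝ} {r : ℝ} :
    IsStableOrbit V r ↔ 0 < deriv (deriv V) r := by
  constructor
  · intro h
    by_contra! hV
    rcases hV.eq_or_lt with h0 | h0
    -- In the marginal case `ξ(τ) = τ` is an unbounded perturbation, so such an orbit is neither
    -- stable nor unstable.
    · obtain ⟨C, hC⟩ := h id fun τ => ⟨differentiableAt_id, by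
        rw [h0, deriv_id']
        simpa using hasDerivAt_const τ (1 : ℝ)⟩
      have := hC (|C| + 1) (by positivity)
      rw [id, abs_of_nonneg (by positivity)] at this
      linarith [le_abs_self C]
    · obtain ⟨C, hC⟩ := h _ (isRadialPerturbation_exp hV)
      refine not_exp_le_affine (Real.sqrt_pos.2 (neg_pos.2 h0)) one_pos
        ((abs_nonneg _).trans (hC 0 le_rfl)) le_rfl fun τ hτ => ?_
      rw [one_mul, zero_mul, add_zero]
      exact (le_abs_self _).trans (hC τ hτ)
  · intro hV ξ hξ
    obtain ⟨C, hC⟩ := hξ.bounded hV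
    exact ⟨C, fun τ _ => hC τ⟩

theorem differentiableAt_deriv_of_contDiffAt {u : ℝ → ℝ} {r : ℝ} (hu : ContDiffAt ℝ 2 u r) :
    DifferentiableAt ℝ (deriv u) r :=
  ((hu.fderiv_right (m := 1) (by norm_num)).clm_apply
    (contDiffAt_const (c := (1 : ℝ)))).differentiableAt (by norm_num)

theorem eventually_differentiableAt_of_contDiffAt {u : ℝ → ℝ} {r : ℝ} (hu : ContDiffAt ℝ 2 u r) :
    ∀ᶠ ρ in nhds r, DifferentiableAt ℝ u ρ :=
  (hu.eventually (by simp)).mono fun _ h => h.differentiableAt (by norm_num)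

/-- At a double zero of `N` the derivatives of `u` drop out of the Leibniz rule. With `u = 1 / (2 f
g)`, this is why `g` enters `V''` only as a positive factor. -/
theorem deriv_deriv_mul_of_zero {N u : ℝ → ℝ} {r : ℝ} (hN : ContDiffAt ℝ 2 N r)
    (hu : ContDiffAt ℝ 2 u r) (h0 : N r = 0) (h1 : deriv N r = 0) :
    deriv (deriv fun ρ => N ρ * u ρ) r = deriv (deriv N) r * u r := by
  have he : deriv (fun ρ => N ρ * u ρ) =ᶠ[nhds r] fun ρ => deriv N ρ * u ρ + N ρ * deriv u ρ := by
    filter_upwards [eventually_differentiableAt_of_contDiffAt hN,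
      eventually_differentiableAt_of_contDiffAt hu] with ρ a b
    exact (a.hasDerivAt.mul b.hasDerivAt).deriv
  rw [he.deriv_eq]
  have dN := (hN.differentiableAt (by norm_num)).hasDerivAt
  have du := (hu.differentiableAt (by norm_num)).hasDerivAt
  have dN' := (differentiableAt_deriv_of_contDiffAt hN).hasDerivAt
  have du' := (differentiableAt_deriv_of_contDiffAt hu).hasDerivAt
  refine ((dN'.mul du).add (dN.mul du')).deriv.trans ?_
  rw [h0, h1]
  ring

/-- The second derivative of the effective potential at the radius of a circular null orbit. -/
theorem deriv_deriv_effectivePotential {f g : ℝ → ℝ} {r E Lsq : ℝ} (hr : 0 < r)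
    (hf : ContDiffAt ℝ 2 f r) (hg : ContDiffAt ℝ 2 g r) (hfr : 0 < f r) (hgr : 0 < g r)
    (hcrit : r * deriv f r = 2 * f r) (hEL : f r / r ^ 2 * Lsq = E ^ 2) :
    deriv (deriv (effectivePotential f g E Lsq)) r =
      Lsq / (2 * r ^ 4 * f r * g r) * (r ^ 2 * deriv (deriv f) r - 2 * f r) := by
  have hr0 := hr.ne'
  -- The first factor vanishes at `r` by nullness (`hEL`), its derivative by `hcrit`.
  have hV : effectivePotential f g E Lsq =
      fun ρ => (f ρ / ρ ^ 2 * Lsq - E ^ 2) * (2 * f ρ * g ρ)⁻¹ := by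
    funext ρ
    rw [effectivePotential, div_eq_mul_inv, neg_sub]
  have hN : ContDiffAt ℝ 2 (fun ρ => f ρ / ρ ^ 2 * Lsq - E ^ 2) r :=
    ((hf.div (contDiffAt_id.pow 2) (by simpa using hr0)).mul contDiffAt_const).sub contDiffAt_const
  have hu : ContDiffAt ℝ 2 (fun ρ => (2 * f ρ * g ρ)⁻¹) r :=
    ((contDiffAt_const.mul hf).mul hg).inv (by positivity)
  have hd : ∀ ρ, 0 < ρ → DifferentiableAt ℝ f ρ →
      HasDerivAt (fun ρ => f ρ / ρ ^ 2 * Lsq - E ^ 2)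
        ((ρ * deriv f ρ - 2 * f ρ) / ρ ^ 3 * Lsq) ρ := fun ρ hρ h => by
    have hρ0 := hρ.ne'
    refine (((h.hasDerivAt.div (hasDerivAt_pow 2 ρ) (by positivity)).mul_const Lsq).sub_const
      _).congr_deriv ?_
    field_simp
    push_cast
    ring
  have he : deriv (fun ρ => f ρ / ρ ^ 2 * Lsq - E ^ 2) =ᶠ[nhds r]
      fun ρ => (ρ * deriv f ρ - 2 * f ρ) / ρ ^ 3 * Lsq := by
    filter_upwards [eventually_differentiableAt_of_contDiffAt hf, lt_mem_nhds hr] with ρ a b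
    exact (hd ρ b a).deriv
  have hf1 := (hf.differentiableAt (by norm_num)).hasDerivAt
  have hf2 := (differentiableAt_deriv_of_contDiffAt hf).hasDerivAt
  have h2 : HasDerivAt (fun ρ => (ρ * deriv f ρ - 2 * f ρ) / ρ ^ 3 * Lsq)
      ((r ^ 2 * deriv (deriv f) r - 2 * f r) / r ^ 4 * Lsq) r := by
    refine (((((hasDerivAt_id r).mul hf2).sub (hf1.const_mul 2)).div (hasDerivAt_pow 3 r)
      (by positivity)).mul_const Lsq).congr_deriv ?_
    have hf' : deriv f r = 2 * f r / r := by
      field_simp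
      linarith
    simp only [Pi.mul_apply, Pi.sub_apply, id, hf']
    field_simp
    push_cast
    ring
  rw [hV, deriv_deriv_mul_of_zero hN hu (by rw [hEL, sub_self])
    (by simp only [he.self_of_nhds, hcrit, sub_self, zero_div, zero_mul]), he.deriv_eq, h2.deriv]
  field_simp

theorem energy_eq {m : ℕ} {σ : SpatialSymmetry} {f g : ℝ → ℝ} (x v : Fin (m + 3) → ℝ) :
    energy σ f g x v = f (x 1) * v 0 := by
  rw [energy, staticMetric_eq, metricInner_diagonal]
  simp [Pi.single_apply]

theorem angularMomentumSq_eq {m : ℕ} {σ : SpatialSymmetry} {f g : ℝ → ℝ} {x v : Fin (m + 3) → ℝ}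
    (hv : v 1 = 0) (hnull : ∑ i, staticCoeff σ f g x i * v i ^ 2 = 0) :
    angularMomentumSq σ f g x v = x 1 ^ 2 * (f (x 1) * v 0 ^ 2) := by
  -- The sum is extended to all indices so that the null condition applies: the added term cancels
  -- the time part, and the radial part is zero.
  have h : ∑ i ∈ Finset.Ici 2, staticMetric σ f g x i i * v i ^ 2 =
      ∑ i, (staticCoeff σ f g x i * v i ^ 2 + if i = 0 then f (x 1) * v 0 ^ 2 else 0) := by
    rw [← Finset.sum_subset (Finset.subset_univ (Finset.Ici 2))]
    · refine Finset.sum_congr rfl fun i hi => ?_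
      rw [if_neg (fin_two_le_iff.1 (Finset.mem_Ici.1 hi)).1, add_zero]
      congr 1
      exact Matrix.diagonal_apply_eq _ _
    · intro i _ hi
      rw [Finset.mem_Ici, fin_two_le_iff] at hi
      by_cases h0 : i = 0
      · subst h0
        simp
      · have h1 : i = 1 := by
          by_contra h1
          exact hi ⟨h0, h1⟩
        subst h1
        simp [hv, fin_zero_ne_one.symm]
  rw [angularMomentumSq, h, Finset.sum_add_distrib, hnull]
  simp

variable {m : ℕ} {σ : SpatialSymmetry} {f g : ℝ → ℝ} {I : Set ℝ}

/-- The second derivative of the potential of a null geodesic along `S_r`. -/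
theorem IsNullGeodesicAlong.deriv_deriv_orbitPotential (hI : IsOpen I)
    (hIpos : ∀ r ∈ I, 0 < r) (hf : ContDiffOn ℝ 2 f I) (hg : ContDiffOn ℝ 2 g I)
    (hfpos : ∀ r ∈ I, 0 < f r) (hgpos : ∀ r ∈ I, 0 < g r) {r ε : ℝ} (hr : r ∈ I)
    {γ : ℝ → Fin (m + 3) → ℝ} (hγ : IsNullGeodesicAlong σ f g I r ε γ) :
    ∃ c > 0, deriv (deriv (orbitPotential σ f g γ)) r =
      c * (r ^ 2 * deriv (deriv f) r - 2 * f r) := by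
  obtain ⟨hU, hγr, hv0, hv1, hn, hcrit⟩ := hγ.crit hI hIpos hf hg hfpos hgpos hr
  have hr0 := hIpos r hr
  have hf0 := hfpos r hr
  have hg0 := hgpos r hr
  have hsq : 0 < deriv γ 0 0 ^ 2 := by positivity
  refine ⟨_, ?_, deriv_deriv_effectivePotential hr0 (hf.contDiffAt (hI.mem_nhds hr))
    (hg.contDiffAt (hI.mem_nhds hr)) hf0 hg0 hcrit ?_⟩
  · rw [angularMomentumSq_eq hv1 hn, hγr]
    positivity
  · rw [angularMomentumSq_eq hv1 hn, energy_eq, hγr]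
    field_simp

/-- Ensures that the quantification over null geodesics in the stability of `S_r` is not vacuous. -/
theorem exists_isNullGeodesicAlong (hI : IsOpen I) (hIpos : ∀ r ∈ I, 0 < r)
    (hf : ContDiffOn ℝ 2 f I) (hg : ContDiffOn ℝ 2 g I) (hfpos : ∀ r ∈ I, 0 < f r)
    (hgpos : ∀ r ∈ I, 0 < g r) {r : ℝ} (hr : r ∈ I) (hcrit : r * deriv f r = 2 * f r) :
    ∃ ε, ∃ γ : ℝ → Fin (m + 3) → ℝ, IsNullGeodesicAlong σ f g I r ε γ := by
  obtain ⟨x, hx, hxr⟩ := exists_mem_staticDomain (m := m) (σ := σ) hr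
  obtain ⟨k, hk, hk1, hn⟩ := exists_tangent_null (σ := σ) (f := f) (g := g) (x := x)
    (hIpos _ hx.1) (hfpos _ hx.1)
  obtain ⟨ε, γ, h, -, -⟩ :=
    exists_nullGeodesicAlong hI hIpos hf hg hfpos hgpos hr hcrit hx hxr hk hk1 hn
  exact ⟨ε, γ, h⟩

theorem isStableSurface_iff (hI : IsOpen I) (hIpos : ∀ r ∈ I, 0 < r)
    (hf : ContDiffOn ℝ 2 f I) (hg : ContDiffOn ℝ 2 g I) (hfpos : ∀ r ∈ I, 0 < f r)
    (hgpos : ∀ r ∈ I, 0 < g r) {r : ℝ} (hr : r ∈ I) (hcrit : r * deriv f r = 2 * f r) :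
    IsStableSurface m σ f g I r ↔ 0 < r ^ 2 * deriv (deriv f) r - 2 * f r := by
  constructor
  · intro h
    obtain ⟨ε, γ, hγ⟩ := exists_isNullGeodesicAlong (m := m) (σ := σ) hI hIpos hf hg hfpos hgpos
      hr hcrit
    obtain ⟨c, hc, he⟩ :=
      hγ.deriv_deriv_orbitPotential hI hIpos hf hg hfpos hgpos hr
    have := isStableOrbit_iff.1 (h ε γ hγ)
    rw [he] at this
    exact pos_of_mul_pos_right this hc.le
  · intro h ε γ hγ
    obtain ⟨c, hc, he⟩ :=
      hγ.deriv_deriv_orbitPotential hI hIpos hf hg hfpos hgpos hr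
    rw [isStableOrbit_iff, he]
    exact mul_pos hc h

theorem isUnstableSurface_iff (hI : IsOpen I) (hIpos : ∀ r ∈ I, 0 < r)
    (hf : ContDiffOn ℝ 2 f I) (hg : ContDiffOn ℝ 2 g I) (hfpos : ∀ r ∈ I, 0 < f r)
    (hgpos : ∀ r ∈ I, 0 < g r) {r : ℝ} (hr : r ∈ I) (hcrit : r * deriv f r = 2 * f r) :
    IsUnstableSurface m σ f g I r ↔ r ^ 2 * deriv (deriv f) r - 2 * f r < 0 := by
  constructor
  · intro h
    obtain ⟨ε, γ, hγ⟩ := exists_isNullGeodesicAlong (m := m) (σ := σ) hI hIpos hf hg hfpos hgpos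
      hr hcrit
    obtain ⟨c, hc, he⟩ :=
      hγ.deriv_deriv_orbitPotential hI hIpos hf hg hfpos hgpos hr
    have := isUnstableOrbit_iff.1 (h ε γ hγ)
    rw [he] at this
    exact neg_of_mul_neg_right this hc.le
  · intro h ε γ hγ
    obtain ⟨c, hc, he⟩ :=
      hγ.deriv_deriv_orbitPotential hI hIpos hf hg hfpos hgpos hr
    rw [isUnstableOrbit_iff, he]
    exact mul_neg_of_pos_of_neg hc h

end Stability

/-! ### Critical points of the radiation fluid and their linearization. -/

section Accretion

/-- With zero trace the characteristic polynomial is `t² + det`. A general field is taken so that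
the real and the complex eigenvalues are both covered. -/
theorem hasEigenvalue_traceless_iff {k : Type*} [Field k] (a b c t : k) :
    Module.End.HasEigenvalue (Matrix.toLin' !![a, b; -c, -a]) t ↔ t ^ 2 = a ^ 2 - b * c := by
  rw [Module.End.hasEigenvalue_iff_isRoot_charpoly, Matrix.charpoly_toLin',
    Matrix.charpoly_fin_two, Polynomial.IsRoot.def]
  simp only [Matrix.trace_fin_two_of, Matrix.det_fin_two_of, Polynomial.eval_add,
    Polynomial.eval_sub, Polynomial.eval_pow, Polynomial.eval_X, Polynomial.eval_mul,
    Polynomial.eval_C]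
  constructor <;> intro h <;> linear_combination h

theorem exists_real_eigenvalues_iff (a b c : ℝ) :
    (∃ s t : ℝ, s < 0 ∧ 0 < t ∧
      Module.End.HasEigenvalue (Matrix.toLin' !![a, b; -c, -a]) s ∧
      Module.End.HasEigenvalue (Matrix.toLin' !![a, b; -c, -a]) t) ↔ b * c - a ^ 2 < 0 := by
  simp only [hasEigenvalue_traceless_iff]
  constructor
  · rintro ⟨s, t, -, ht, -, h⟩
    have : 0 < t ^ 2 := by positivity
    linarith
  · intro h
    have h' : 0 < a ^ 2 - b * c := by linarith
    exact ⟨-√(a ^ 2 - b * c), √(a ^ 2 - b * c), neg_lt_zero.2 (Real.sqrt_pos.2 h'),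
      Real.sqrt_pos.2 h', by rw [neg_sq, Real.sq_sqrt h'.le], Real.sq_sqrt h'.le⟩

theorem exists_imaginary_eigenvalues_iff (a b c : ℝ) :
    (∃ w : ℝ, 0 < w ∧
      Module.End.HasEigenvalue
        (Matrix.toLin' (!![a, b; -c, -a].map (fun x : ℝ => (x : ℂ)))) (w * Complex.I) ∧
      Module.End.HasEigenvalue
        (Matrix.toLin' (!![a, b; -c, -a].map (fun x : ℝ => (x : ℂ)))) (-(w * Complex.I))) ↔
      0 < b * c - a ^ 2 := by
  have hM : !![a, b; -c, -a].map (fun x : ℝ => (x : ℂ)) =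
      !![(a : ℂ), (b : ℂ); -(c : ℂ), -(a : ℂ)] := by
    ext i j
    fin_cases i <;> fin_cases j <;> simp
  have hw : ∀ w : ℝ, (w * Complex.I) ^ 2 = (a : ℂ) ^ 2 - b * c ↔ w ^ 2 = b * c - a ^ 2 := by
    intro w
    rw [mul_pow, Complex.I_sq, ← Complex.ofReal_inj]
    push_cast
    constructor <;> intro h <;> linear_combination -h
  simp only [hM, hasEigenvalue_traceless_iff, neg_sq, hw, and_self]
  constructor
  · rintro ⟨w, hw0, h⟩
    rw [← h]
    positivity
  · intro h
    exact ⟨√(b * c - a ^ 2), Real.sqrt_pos.2 h, Real.sq_sqrt h.le⟩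

variable {m : ℕ} {f : ℝ → ℝ} {I : Set ℝ} {K μ : ℝ}

/-- The flux term `μ² / ρ^{2(D-2)}` for `D = m + 3`. -/
def fluxTerm (m : ℕ) (μ ρ : ℝ) : ℝ := μ ^ 2 / ρ ^ (2 * (m + 1))

theorem hasDerivAt_fluxTerm {ρ : ℝ} (hρ : ρ ≠ 0) :
    HasDerivAt (fluxTerm m μ) (-(2 * (m + 1)) * fluxTerm m μ ρ / ρ) ρ := by
  refine ((hasDerivAt_const ρ (μ ^ 2)).div (hasDerivAt_pow (2 * (m + 1)) ρ)
    (pow_ne_zero _ hρ)).congr_deriv ?_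
  rw [fluxTerm, show 2 * (m + 1) - 1 = 2 * m + 1 by omega,
    show 2 * (m + 1) = 2 * m + 2 by omega]
  field_simp
  push_cast
  ring

theorem fluxTerm_pos (hμ : μ ≠ 0) {ρ : ℝ} (hρ : 0 < ρ) : 0 < fluxTerm m μ ρ := by
  unfold fluxTerm
  positivity

/-- Here `γ - 1 = 1 / (D - 1) = 1 / (m + 2)`, whence the exponent `2 / (m + 2)` of `h²`. -/
theorem radiationF_eq {ν : ℝ} (hν : 0 < ν) (ρ : ℝ) :
    radiationF (m + 3) f K μ ρ ν =
      K ^ 2 * ν ^ (2 / ((m : ℝ) + 2)) * (f ρ + fluxTerm m μ ρ / ν ^ 2) := by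
  have h : ((((m + 3 : ℕ) : ℝ) - 1 + 1) / (((m + 3 : ℕ) : ℝ) - 1) - 1) = 1 / ((m : ℝ) + 2) := by
    push_cast
    have : (m : ℝ) + 3 - 1 ≠ 0 := by
      have : (0 : ℝ) ≤ m := Nat.cast_nonneg m
      linarith
    have : (m : ℝ) + 2 ≠ 0 := by positivity
    field_simp
    ring
  rw [radiationF, accretionF, radiationEnthalpy, h, mul_pow, ← Real.rpow_mul_natCast hν.le,
    fluxTerm, show m + 3 - 2 = m + 1 by omega, div_div]
  norm_num
  left
  left
  congr 1
  ring

theorem hasDerivAt_rpow_div {P ν : ℝ} (hν : 0 < ν) :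
    HasDerivAt (fun x : ℝ => x ^ P) (P * ν ^ P / ν) ν := by
  refine (Real.hasDerivAt_rpow_const (Or.inl hν.ne')).congr_deriv ?_
  rw [Real.rpow_sub_one hν.ne', mul_div_assoc]

theorem partialN_radiationF {ν : ℝ} (hν : 0 < ν) (ρ : ℝ) :
    partialN (radiationF (m + 3) f K μ) ρ ν =
      K ^ 2 * ν ^ (2 / ((m : ℝ) + 2)) * (2 / ((m : ℝ) + 2) * f ρ / ν +
        (2 / ((m : ℝ) + 2) - 2) * fluxTerm m μ ρ / ν ^ 3) := by
  have he : (fun x => radiationF (m + 3) f K μ ρ x) =ᶠ[nhds ν] fun x =>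
      K ^ 2 * x ^ (2 / ((m : ℝ) + 2)) * (f ρ + fluxTerm m μ ρ / x ^ 2) := by
    filter_upwards [lt_mem_nhds hν] with x hx
    exact radiationF_eq hx ρ
  rw [partialN, he.deriv_eq]
  generalize 2 / ((m : ℝ) + 2) = P
  refine (((hasDerivAt_rpow_div (P := P) hν).const_mul (K ^ 2)).mul
    (((hasDerivAt_const ν (fluxTerm m μ ρ)).div (hasDerivAt_pow 2 ν)
      (by positivity)).const_add (f ρ))).deriv.trans ?_
  simp only [Pi.div_apply]
  field_simp
  push_cast
  ring

theorem partialN_partialN_radiationF {ν : ℝ} (hν : 0 < ν) (ρ : ℝ) :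
    partialN (partialN (radiationF (m + 3) f K μ)) ρ ν =
      K ^ 2 * ν ^ (2 / ((m : ℝ) + 2)) *
        (2 / ((m : ℝ) + 2) * (2 / ((m : ℝ) + 2) - 1) * f ρ / ν ^ 2 +
        (2 / ((m : ℝ) + 2) - 2) * (2 / ((m : ℝ) + 2) - 3) * fluxTerm m μ ρ / ν ^ 4) := by
  have he : (fun x => partialN (radiationF (m + 3) f K μ) ρ x) =ᶠ[nhds ν] fun x =>
      K ^ 2 * x ^ (2 / ((m : ℝ) + 2)) * (2 / ((m : ℝ) + 2) * f ρ / x +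
        (2 / ((m : ℝ) + 2) - 2) * fluxTerm m μ ρ / x ^ 3) := by
    filter_upwards [lt_mem_nhds hν] with x hx
    exact partialN_radiationF hx ρ
  rw [partialN, he.deriv_eq]
  generalize 2 / ((m : ℝ) + 2) = P
  refine (((hasDerivAt_rpow_div (P := P) hν).const_mul (K ^ 2)).mul
    (((hasDerivAt_const ν (P * f ρ)).div (hasDerivAt_id ν) hν.ne').add
      ((hasDerivAt_const ν ((P - 2) * fluxTerm m μ ρ)).div (hasDerivAt_pow 3 ν)
      (by positivity)))).deriv.trans ?_
  simp only [Pi.div_apply, Pi.add_apply, id]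
  field_simp
  push_cast
  ring

theorem partialR_radiationF {ρ ν : ℝ} (hρ : 0 < ρ) (hf : DifferentiableAt ℝ f ρ) (hν : 0 < ν) :
    partialR (radiationF (m + 3) f K μ) ρ ν =
      K ^ 2 * ν ^ (2 / ((m : ℝ) + 2)) *
        (deriv f ρ - 2 * (m + 1) * fluxTerm m μ ρ / ρ / ν ^ 2) := by
  rw [partialR, funext (radiationF_eq hν)]
  refine ((hf.hasDerivAt.add ((hasDerivAt_fluxTerm hρ.ne').div_const (ν ^ 2))).const_mul
    _).deriv.trans ?_
  ring

theorem partialR_partialN_radiationF {ρ ν : ℝ} (hρ : 0 < ρ) (hf : DifferentiableAt ℝ f ρ)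
    (hν : 0 < ν) :
    partialR (partialN (radiationF (m + 3) f K μ)) ρ ν =
      K ^ 2 * ν ^ (2 / ((m : ℝ) + 2)) * (2 / ((m : ℝ) + 2) * deriv f ρ / ν -
        (2 / ((m : ℝ) + 2) - 2) * (2 * (m + 1)) * fluxTerm m μ ρ / ρ / ν ^ 3) := by
  rw [partialR, funext (partialN_radiationF hν)]
  refine ((((hf.hasDerivAt.const_mul _).div_const ν).add
    (((hasDerivAt_fluxTerm hρ.ne').const_mul _).div_const (ν ^ 3))).const_mul _).deriv.trans ?_
  ring

theorem partialR_partialR_radiationF {ρ ν : ℝ} (hρ : 0 < ρ) (hf : ContDiffAt ℝ 2 f ρ)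
    (hν : 0 < ν) :
    partialR (partialR (radiationF (m + 3) f K μ)) ρ ν =
      K ^ 2 * ν ^ (2 / ((m : ℝ) + 2)) *
        (deriv (deriv f) ρ +
          2 * (m + 1) * (2 * (m + 1) + 1) * fluxTerm m μ ρ / ρ ^ 2 / ν ^ 2) := by
  have he : (fun x => partialR (radiationF (m + 3) f K μ) x ν) =ᶠ[nhds ρ] fun x =>
      K ^ 2 * ν ^ (2 / ((m : ℝ) + 2)) *
        (deriv f x - 2 * (m + 1) * fluxTerm m μ x / x / ν ^ 2) := by
    filter_upwards [lt_mem_nhds hρ, eventually_differentiableAt_of_contDiffAt hf] with x hx h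
    exact partialR_radiationF hx h hν
  rw [partialR, he.deriv_eq]
  refine (((differentiableAt_deriv_of_contDiffAt hf).hasDerivAt.sub
    ((((hasDerivAt_fluxTerm hρ.ne').const_mul (2 * ((m : ℝ) + 1))).div (hasDerivAt_id ρ)
      hρ.ne').div_const (ν ^ 2))).const_mul _).deriv.trans ?_
  simp only [id]
  field_simp
  ring

/-- The critical points of the accretion problem. -/
theorem isCriticalPoint_radiationF_iff {r n : ℝ} (hr : 0 < r) (hf : DifferentiableAt ℝ f r)
    (hK : 0 < K) :
    IsCriticalPoint (radiationF (m + 3) f K μ) r n ↔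
      0 < n ∧ f r * n ^ 2 = (m + 1) * fluxTerm m μ r ∧ r * deriv f r = 2 * f r := by
  refine and_congr_right fun hn => ?_
  have hc : K ^ 2 * n ^ (2 / ((m : ℝ) + 2)) ≠ 0 := by positivity
  have hm : (m : ℝ) + 2 ≠ 0 := by positivity
  rw [partialN_radiationF hn, partialR_radiationF hr hf hn, mul_eq_zero_iff_left hc,
    mul_eq_zero_iff_left hc]
  have h1 : 2 / ((m : ℝ) + 2) * f r / n + (2 / ((m : ℝ) + 2) - 2) * fluxTerm m μ r / n ^ 3 = 0 ↔
      f r * n ^ 2 = (m + 1) * fluxTerm m μ r := by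
    -- With `P = 2 / (m + 2)` one has `P - 2 = -(m + 1) P`, the origin of the factor `m + 1`.
    have e : 2 / ((m : ℝ) + 2) * f r / n + (2 / ((m : ℝ) + 2) - 2) * fluxTerm m μ r / n ^ 3 =
        2 / (((m : ℝ) + 2) * n ^ 3) * (f r * n ^ 2 - (m + 1) * fluxTerm m μ r) := by
      field_simp
      ring
    rw [e, mul_eq_zero_iff_left (by positivity), sub_eq_zero]
  rw [h1]
  refine and_congr_right fun h => ?_
  have e : deriv f r - 2 * (m + 1) * fluxTerm m μ r / r / n ^ 2 =
      1 / r * (r * deriv f r - 2 * f r) := by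
    have : 2 * (m + 1) * fluxTerm m μ r / r / n ^ 2 = 2 * f r / r := by
      rw [mul_assoc, ← h]
      field_simp
    rw [this]
    field_simp
  rw [e, mul_eq_zero_iff_left (by positivity), sub_eq_zero]

theorem existsUnique_density {r : ℝ} (hr : 0 < r) (hf : 0 < f r) (hμ : μ ≠ 0) :
    ∃! n : ℝ, 0 < n ∧ f r * n ^ 2 = (m + 1) * fluxTerm m μ r := by
  have hB := fluxTerm_pos (m := m) hμ hr
  have hp : 0 < (m + 1) * fluxTerm m μ r / f r := by positivity
  refine ⟨√((m + 1) * fluxTerm m μ r / f r), ⟨Real.sqrt_pos.2 hp, ?_⟩, ?_⟩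
  · rw [Real.sq_sqrt hp.le]
    field_simp
  · rintro n ⟨hn, h⟩
    rw [← h, mul_div_cancel_left₀ _ hf.ne', Real.sqrt_sq hn.le]

/-- The determinant of the linearisation at a critical point. -/
theorem linearization_det_radiationF {r n : ℝ} (hr : 0 < r) (hf : ContDiffAt ℝ 2 f r)
    (hfr : 0 < f r) (hK : 0 < K) (hcp : IsCriticalPoint (radiationF (m + 3) f K μ) r n) :
    ∃ c > 0, partialN (partialN (radiationF (m + 3) f K μ)) r n *
        partialR (partialR (radiationF (m + 3) f K μ)) r n -
        partialR (partialN (radiationF (m + 3) f K μ)) r n ^ 2 =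
      c * (r ^ 2 * deriv (deriv f) r - 2 * f r) := by
  have hd : DifferentiableAt ℝ f r := hf.differentiableAt (by norm_num)
  obtain ⟨hn, h1, h2⟩ := (isCriticalPoint_radiationF_iff hr hd hK).1 hcp
  have hm : (0 : ℝ) ≤ m := Nat.cast_nonneg m
  -- The two critical point equations eliminate `μ` and `f'` from the second derivatives.
  have hB : fluxTerm m μ r = f r * n ^ 2 / (m + 1) := by
    field_simp
    linarith
  have hf' : deriv f r = 2 * f r / r := by
    field_simp
    linarith
  rw [partialN_partialN_radiationF hn, partialR_partialR_radiationF hr hf hn,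
    partialR_partialN_radiationF hr hd hn, hB, hf']
  have hw : 0 < n ^ (2 / ((m : ℝ) + 2)) := by positivity
  generalize n ^ (2 / ((m : ℝ) + 2)) = w at hw
  -- With `W = K² w`, the entries become `F_nn = 4 W f / ((m + 2) n²)`, `F_rn = 4 W f / (r n)` and
  -- `F_rr = W (f'' + (4 m + 6) f / r²)`. The factor is `F_nn W / r²`.
  refine ⟨(K ^ 2 * w) ^ 2 * (4 * f r / ((m + 2) * n ^ 2)) / r ^ 2, by positivity, ?_⟩
  field_simp
  ring

theorem linearizationMatrix_saddle_extremum_iff {F : ℝ → ℝ → ℝ} {r n : ℝ}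
    (h : IsCriticalPoint F r n) :
    (IsSaddlePoint F r n ↔ partialN (partialN F) r n * partialR (partialR F) r n -
      partialR (partialN F) r n ^ 2 < 0) ∧
    (IsExtremumPoint F r n ↔ 0 < partialN (partialN F) r n * partialR (partialR F) r n -
      partialR (partialN F) r n ^ 2) := by
  rw [← exists_real_eigenvalues_iff, ← exists_imaginary_eigenvalues_iff]
  exact ⟨and_iff_right h, and_iff_right h⟩

end Accretion

end PhotonFluid

end

/-- Critical points of radiation fluid flow correspond one-to-one to constant-radius photon
surfaces; stable surfaces correspond to extremum points and unstable ones to saddle points. -/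
theorem mainTheorem6 (m D : ℕ) (hD : D = m + 3) (σ : PhotonFluid.SpatialSymmetry)
    (I : Set ℝ) (hI : IsOpen I) (hIpos : ∀ r ∈ I, 0 < r)
    (f g : ℝ → ℝ) (hf : ContDiffOn ℝ 2 f I) (hg : ContDiffOn ℝ 2 g I)
    (hfpos : ∀ r ∈ I, 0 < f r) (hgpos : ∀ r ∈ I, 0 < g r)
    (K μ : ℝ) (hK : 0 < K) (hμ : μ ≠ 0) (r : ℝ) (hr : r ∈ I) :
    ((∃ n, PhotonFluid.IsCriticalPoint (PhotonFluid.radiationF D f K μ) r n) ↔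
      PhotonFluid.IsConstRadiusPhotonSurface m σ f g I r) ∧
    (PhotonFluid.IsConstRadiusPhotonSurface m σ f g I r →
      ∃! n, PhotonFluid.IsCriticalPoint (PhotonFluid.radiationF D f K μ) r n) ∧
    (∀ n, PhotonFluid.IsCriticalPoint (PhotonFluid.radiationF D f K μ) r n →
      (PhotonFluid.IsStableSurface m σ f g I r ↔
        PhotonFluid.IsExtremumPoint (PhotonFluid.radiationF D f K μ) r n) ∧
      (PhotonFluid.IsUnstableSurface m σ f g I r ↔
        PhotonFluid.IsSaddlePoint (PhotonFluid.radiationF D f K μ) r n)) := by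
  subst hD
  have hr0 := hIpos r hr
  have hfr := hfpos r hr
  have hf2 : ContDiffAt ℝ 2 f r := hf.contDiffAt (hI.mem_nhds hr)
  have hcp := fun n => PhotonFluid.isCriticalPoint_radiationF_iff (m := m) (n := n) (μ := μ) hr0
    (hf2.differentiableAt (by norm_num)) hK
  rw [PhotonFluid.isConstRadiusPhotonSurface_iff hI hIpos hf hg hfpos hgpos hr]
  obtain ⟨n₀, hn₀, huniq⟩ := PhotonFluid.existsUnique_density (m := m) hr0 hfr hμ
  refine ⟨⟨fun ⟨n, h⟩ => ((hcp n).1 h).2.2, fun h => ⟨n₀, (hcp n₀).2 ⟨hn₀.1, hn₀.2, h⟩⟩⟩,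
    fun h => ⟨n₀, (hcp n₀).2 ⟨hn₀.1, hn₀.2, h⟩, fun n hn => ?_⟩, fun n hn => ?_⟩
  · obtain ⟨h1, h2, -⟩ := (hcp n).1 hn
    exact huniq n ⟨h1, h2⟩
  · have hcrit := ((hcp n).1 hn).2.2
    obtain ⟨c, hc, hdet⟩ := PhotonFluid.linearization_det_radiationF hr0 hf2 hfr hK hn
    obtain ⟨hs, he⟩ := PhotonFluid.linearizationMatrix_saddle_extremum_iff hn
    rw [PhotonFluid.isStableSurface_iff hI hIpos hf hg hfpos hgpos hr hcrit,
      PhotonFluid.isUnstableSurface_iff hI hIpos hf hg hfpos hgpos hr hcrit, hs, he, hdet]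
    exact ⟨(mul_pos_iff_of_pos_left hc).symm, ⟨fun h => mul_neg_of_pos_of_neg hc h,
      fun h => neg_of_mul_neg_right h hc.le⟩⟩
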